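/- Let $\mu,\beta>0$. For $r>0$ let $G_1(r)=\frac i4 H_0^{(1)}(ir)$ ($H^{(1)}_0$ the Hankel function of the first kind) be the radial Green function of $-\Delta+1$ in the plane, and $Q(r)=\frac1r\big(G_1'(r)+\frac1{2\pi r}\big)$. For a function $R$ on $\mathbb R$ let $$\kappa_R=\frac{R^2+2(R')^2-RR''}{[R^2+(R')^2]^{3/2}},\qquad D_\tau[R](\hat\theta,\theta)=\sqrt{R^2(\hat\theta)+R^2(\theta)-2R(\hat\theta)R(\theta)\cos(\hat\theta-\theta)+\tau^2},$$ and for $\tau>0$, writing $D_\tau=D_\tau[R](\hat\theta,\theta)$, $$\mathcal L_\tau[R](\hat\theta)=\int_0^{2\pi}\Big[\beta\, G_1(D_\tau)\sqrt{R'(\theta)^2+R(\theta)^2}-\Big((\mu+\kappa_R(\theta))\,Q(D_\tau)-\frac{\kappa_R(\theta)-\kappa_R(\hat\theta)}{2\pi D_\tau^2}\Big)\big(R^2(\theta)+R(\hat\theta)R'(\theta)\sin(\hat\theta-\theta)-R(\hat\theta)R(\theta)\cos(\hat\theta-\theta)\big)\Big]d\theta .$$ Let $\nu$ be a probability density on $[0,2\pi]$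 and define the loss $$J_\tau(\rho)=\int_0^{2\pi}\big(\mathcal L_\tau[\rho](\hat\theta)\big)^2\nu(\hat\theta)\,d\hat\theta+\sum_{\alpha=0}^2\big(D^\alpha\rho(0)-D^\alpha\rho(2\pi)\big)^2 .$$ **Theorem.** Let $\Psi\in C^3(\mathbb R)$ be bounded and nonconstant. Let $R\in C^3(\mathbb R)$ be positive, $2\pi$-periodic, and the boundary of a solution of the stationary free boundary problem: with $\Omega=\{(r\cos\theta,r\sin\theta):0\le r<R(\theta)\}$ and $\mathbf n$ the outward unit normal there is $\sigma\in C^2(\Omega)\cap C^1(\overline\Omega)$ such that $$-\Delta\sigma=-\sigma\ \text{ in }\Omega,\qquad \sigma=\mu+\kappa_R\ \text{ and }\ \frac{\partial\sigma}{\partial \mathbf n}=\beta\ \text{ on }\partial\Omega .$$ Then there is a constant $K>0$ such that for every $0<\delta<1$ there are $N\ge1$ and a single-hidden-layer network $\rho(\theta)=\sum_{i=1}^N a_i\Psi(b_i\theta+c_i)+d$ with real parameters $a_i,b_i,c_i,d$ which is positive on $[0,2\pi]$ and satisfies $$\max_{0\le\alpha\le3}\ \sup_{\theta\in[0,2\pi]}|D^\alpha\rho(\theta)-D^\alpha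 R(\theta)|\le\delta\qquad\text{and}\qquad J_\tau(\rho)\le K\,\delta^{1/8}\quad\text{with }\tau=\delta^{1/8}.$$ The constant $K$ does not depend on $\delta$. -/

import Mathlib

open scoped Gradient

noncomputable section

namespace HeleShaw

/-- The Bessel function of the first kind of order zero, by its power series. -/
def besselJ0 (z : ℂ) : ℂ :=
  ∑' k : ℕ, (-1 : ℂ) ^ k * (z ^ 2 / 4) ^ k / ((k.factorial : ℂ) ^ 2)

/-- The Bessel function of the second kind of order zero (principal branch),
`Y₀(z) = (2/π)(log (z/2) + γ) J₀(z) - (2/π) ∑ₖ (-1)ᵏ Hₖ (z²/4)ᵏ / (k!)²`,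
with `Hₖ` the harmonic numbers. -/
def besselY0 (z : ℂ) : ℂ :=
  (2 / (Real.pi : ℂ)) * (Complex.log (z / 2) + (Real.eulerMascheroniConstant : ℂ)) * besselJ0 z
    - (2 / (Real.pi : ℂ)) * ∑' k : ℕ, (-1 : ℂ) ^ k * ((harmonic k : ℚ) : ℂ) * (z ^ 2 / 4) ^ k
        / ((k.factorial : ℂ) ^ 2)

/-- The Hankel function of the first kind of order zero. -/
def hankelH0 (z : ℂ) : ℂ := besselJ0 z + Complex.I * besselY0 z

/-- The radial Green function `G₁(r) = (i/4) H₀⁽¹⁾(i r)` of `-Δ + 1` in the plane, for `r > 0`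
(the right-hand side is real there; see `ofReal_greenG`). -/
def greenG (r : ℝ) : ℝ := (Complex.I / 4 * hankelH0 (Complex.I * (r : ℂ))).re

/-- For `r > 0` the complex number `(i/4) H₀⁽¹⁾(i r)` is real, so that `greenG` loses nothing. -/
theorem ofReal_greenG {r : ℝ} (hr : 0 < r) :
    ((greenG r : ℝ) : ℂ) = Complex.I / 4 * hankelH0 (Complex.I * (r : ℂ)) := by
  have hI : Complex.I ^ 2 = -1 := Complex.I_sq
  have hJ : besselJ0 (Complex.I * (r : ℂ))
      = ((∑' k : ℕ, (r ^ 2 / 4) ^ k / ((k.factorial : ℝ) ^ 2) : ℝ) : ℂ) := by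
    rw [besselJ0, Complex.ofReal_tsum]
    refine tsum_congr fun k => ?_
    push_cast
    rw [mul_pow, hI, ← mul_pow]
    congr 2
    ring
  have hS : (∑' k : ℕ, (-1 : ℂ) ^ k * ((harmonic k : ℚ) : ℂ) * ((Complex.I * (r : ℂ)) ^ 2 / 4) ^ k
        / ((k.factorial : ℂ) ^ 2))
      = ((∑' k : ℕ, ((harmonic k : ℚ) : ℝ) * (r ^ 2 / 4) ^ k / ((k.factorial : ℝ) ^ 2) : ℝ) : ℂ) := by
    rw [Complex.ofReal_tsum]
    refine tsum_congr fun k => ?_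
    push_cast
    rw [mul_pow, hI, mul_right_comm, ← mul_pow, mul_comm (_ ^ k)]
    congr 3
    ring
  have hL : Complex.log (Complex.I * (r : ℂ) / 2)
      = ((Real.log (r / 2) : ℝ) : ℂ) + (Real.pi : ℂ) / 2 * Complex.I := by
    have h2 : Complex.I * (r : ℂ) / 2 = ((r / 2 : ℝ) : ℂ) * Complex.I := by push_cast; ring
    rw [h2, Complex.log_ofReal_mul (by positivity) Complex.I_ne_zero, Complex.log_I]
  have key : ∃ x : ℝ, Complex.I / 4 * hankelH0 (Complex.I * (r : ℂ)) = (x : ℂ) := by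
    rw [hankelH0, besselY0, hS, hJ, hL]
    set A : ℝ := ∑' k : ℕ, (r ^ 2 / 4) ^ k / ((k.factorial : ℝ) ^ 2)
    set B : ℝ := ∑' k : ℕ, ((harmonic k : ℚ) : ℝ) * (r ^ 2 / 4) ^ k / ((k.factorial : ℝ) ^ 2)
    refine ⟨-(1 / (2 * Real.pi)) *
      ((Real.log (r / 2) + Real.eulerMascheroniConstant) * A - B), ?_⟩
    have hpi : (Real.pi : ℂ) ≠ 0 := by exact_mod_cast Real.pi_ne_zero
    push_cast
    field_simp
    ring_nf
    simp only [Complex.I_sq, show Complex.I ^ 3 = -Complex.I by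
      rw [pow_succ, Complex.I_sq]; ring]
    ring
  obtain ⟨x, hx⟩ := key
  rw [greenG, hx, Complex.ofReal_re]

/-- `Q(r) = (1/r) (G₁'(r) + 1/(2πr))`. -/
def kernelQ (r : ℝ) : ℝ := 1 / r * (deriv greenG r + 1 / (2 * Real.pi * r))

/-- Curvature of the polar curve `r = R(θ)`. -/
def curvature (R : ℝ → ℝ) (θ : ℝ) : ℝ :=
  (R θ ^ 2 + 2 * deriv R θ ^ 2 - R θ * iteratedDeriv 2 R θ)
    / (R θ ^ 2 + deriv R θ ^ 2) ^ (3 / 2 : ℝ)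

/-! The stationary free boundary problem -/

/-- The point with polar coordinates `(r, θ)`. -/
def polarPoint (r θ : ℝ) : EuclideanSpace ℝ (Fin 2) :=
  !₂[r * Real.cos θ, r * Real.sin θ]

/-- The region `{r < R(θ)}` enclosed by the curve `r = R(θ)`. -/
def domain (R : ℝ → ℝ) : Set (EuclideanSpace ℝ (Fin 2)) :=
  {x | ∃ r θ : ℝ, 0 ≤ r ∧ r < R θ ∧ x = polarPoint r θ}

/-- Outward unit normal of the curve `r = R(θ)` at the point with parameter `θ`. -/
def normal (R : ℝ → ℝ) (θ : ℝ) : EuclideanSpace ℝ (Fin 2) :=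
  (1 / Real.sqrt (deriv R θ ^ 2 + R θ ^ 2)) •
    !₂[deriv R θ * Real.sin θ + R θ * Real.cos θ, -(deriv R θ * Real.cos θ) + R θ * Real.sin θ]

/-- `σ` is a classical solution, `σ ∈ C²(Ω) ∩ C¹(Ω̄)`, of the overdetermined problem
`-Δσ = -σ` in `Ω`, `σ = μ + κ` and `∂σ/∂n = β` on `∂Ω`, where `Ω = {r < R(θ)}`.
That `σ` is `C¹` up to the boundary means that `σ` is continuous on `Ω̄` and that its gradient
has a continuous extension `V` to `Ω̄`; `V` gives the normal derivative on `∂Ω`. -/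
structure IsClassicalSolution (μ β : ℝ) (R : ℝ → ℝ) (σ : EuclideanSpace ℝ (Fin 2) → ℝ) :
    Prop where
  contDiffOn : ContDiffOn ℝ 2 σ (domain R)
  continuousOn : ContinuousOn σ (closure (domain R))
  equation : ∀ x ∈ domain R, -(Laplacian.laplacian σ x) = -σ x
  dirichlet : ∀ θ : ℝ, σ (polarPoint (R θ) θ) = μ + curvature R θ
  neumann : ∃ V : EuclideanSpace ℝ (Fin 2) → EuclideanSpace ℝ (Fin 2),
    ContinuousOn V (closure (domain R)) ∧ (∀ x ∈ domain R, V x = ∇ σ x) ∧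
      ∀ θ : ℝ, inner ℝ (V (polarPoint (R θ) θ)) (normal R θ) = β

/-- `r = R(θ)` is a `C³`, `2π`-periodic, positive polar curve (it stays away from the origin)
which is the free boundary of a solution of the stationary problem. -/
structure IsSolutionBoundary (μ β : ℝ) (R : ℝ → ℝ) : Prop where
  contDiff : ContDiff ℝ 3 R
  periodic : Function.Periodic R (2 * Real.pi)
  pos : ∀ θ : ℝ, 0 < R θ
  exists_solution : ∃ σ : EuclideanSpace ℝ (Fin 2) → ℝ, IsClassicalSolution μ β R σ

/-! The regularized boundary integral operator and the loss -/

/-- Regularized distance `D_τ[R]` between the curve points with parameters `φ` and `θ`. -/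
def regDist (τ : ℝ) (R : ℝ → ℝ) (φ θ : ℝ) : ℝ :=
  Real.sqrt (R φ ^ 2 + R θ ^ 2 - 2 * R φ * R θ * Real.cos (φ - θ) + τ ^ 2)

/-- The regularized boundary integral operator `𝓛_τ[R]`, evaluated at `φ`. -/
def boundaryOp (μ β τ : ℝ) (R : ℝ → ℝ) (φ : ℝ) : ℝ :=
  ∫ θ in (0 : ℝ)..(2 * Real.pi),
    (β * greenG (regDist τ R φ θ) * Real.sqrt (deriv R θ ^ 2 + R θ ^ 2)
      - ((μ + curvature R θ) * kernelQ (regDist τ R φ θ)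
          - (curvature R θ - curvature R φ) / (2 * Real.pi * regDist τ R φ θ ^ 2))
        * (R θ ^ 2 + R φ * deriv R θ * Real.sin (φ - θ) - R φ * R θ * Real.cos (φ - θ)))

/-- `ν` is a probability density on `[0, 2π]`. -/
structure IsDensity (ν : ℝ → ℝ) : Prop where
  nonneg : ∀ φ ∈ Set.Icc (0 : ℝ) (2 * Real.pi), 0 ≤ ν φ
  integrable : IntervalIntegrable ν MeasureTheory.volume 0 (2 * Real.pi)
  integral_eq_one : ∫ φ in (0 : ℝ)..(2 * Real.pi), ν φ = 1

/-- The loss `J`: mean square of the regularized residual under the sampling density `ν`,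
plus the periodicity penalty for the derivatives of order `0, 1, 2`. -/
def loss (μ β τ : ℝ) (ν ρ : ℝ → ℝ) : ℝ :=
  (∫ φ in (0 : ℝ)..(2 * Real.pi), boundaryOp μ β τ ρ φ ^ 2 * ν φ)
    + ∑ α ∈ Finset.range 3, (iteratedDeriv α ρ 0 - iteratedDeriv α ρ (2 * Real.pi)) ^ 2

/-- Networks with one hidden layer of width `N`: `ρ(θ) = ∑ᵢ aᵢ Ψ(bᵢ θ + cᵢ) + d`. -/
def networks (Ψ : ℝ → ℝ) (N : ℕ) : Set (ℝ → ℝ) :=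
  {ρ | ∃ (a b c : Fin N → ℝ) (d : ℝ), ρ = fun θ => ∑ i, a i * Ψ (b i * θ + c i) + d}

end HeleShaw

end

open MeasureTheory Filter Topology Set

noncomputable section

namespace HeleShaw

/-! Polynomial functions of bounded degree -/

/-- The space of polynomial functions of degree less than `k`. -/
def polyBelow (k : ℕ) : Submodule ℝ (ℝ → ℝ) :=
  Submodule.span ℝ (range fun i : Fin k => fun x : ℝ => x ^ (i : ℕ))

theorem isClosed_polyBelow (k : ℕ) : IsClosed (polyBelow k : Set (ℝ → ℝ)) := by
  have : FiniteDimensional ℝ (polyBelow k) :=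
    FiniteDimensional.span_of_finite ℝ (Set.finite_range _)
  exact Submodule.closed_of_finiteDimensional _

theorem pow_mem_polyBelow {i k : ℕ} (h : i < k) : (fun x : ℝ => x ^ i) ∈ polyBelow k :=
  Submodule.subset_span ⟨⟨i, h⟩, rfl⟩

theorem const_mem_polyBelow (k : ℕ) (c : ℝ) : (fun _ : ℝ => c) ∈ polyBelow (k + 1) := by
  have := (polyBelow (k + 1)).smul_mem c (pow_mem_polyBelow (Nat.succ_pos k))
  convert this using 1
  ext x
  simp

theorem exists_antideriv_mem_polyBelow {k : ℕ} {p : ℝ → ℝ} (hp : p ∈ polyBelow k) :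
    ∃ q ∈ polyBelow (k + 1), ∀ x, HasDerivAt q (p x) x := by
  induction hp using Submodule.span_induction with
  | mem p hp =>
    obtain ⟨i, rfl⟩ := hp
    refine ⟨(((i : ℕ) : ℝ) + 1)⁻¹ • fun x => x ^ ((i : ℕ) + 1),
      Submodule.smul_mem _ _ (pow_mem_polyBelow (by omega)), fun x => ?_⟩
    have h := (hasDerivAt_pow ((i : ℕ) + 1) x).const_smul (((i : ℕ) : ℝ) + 1)⁻¹
    refine h.congr_deriv ?_
    have : ((i : ℕ) : ℝ) + 1 ≠ 0 := by positivity
    rw [smul_eq_mul, Nat.add_sub_cancel]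
    push_cast
    field_simp
  | zero => exact ⟨0, Submodule.zero_mem _, fun x => hasDerivAt_const x 0⟩
  | add p₁ p₂ _ _ h₁ h₂ =>
    obtain ⟨q₁, hq₁, hd₁⟩ := h₁
    obtain ⟨q₂, hq₂, hd₂⟩ := h₂
    exact ⟨q₁ + q₂, Submodule.add_mem _ hq₁ hq₂, fun x => (hd₁ x).add (hd₂ x)⟩
  | smul a p _ h =>
    obtain ⟨q, hq, hd⟩ := h
    exact ⟨a • q, Submodule.smul_mem _ _ hq, fun x => (hd x).const_smul a⟩

theorem mem_polyBelow_of_deriv {k : ℕ} {f : ℝ → ℝ} (hf : Differentiable ℝ f)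
    (h : deriv f ∈ polyBelow k) : f ∈ polyBelow (k + 1) := by
  obtain ⟨q, hq, hd⟩ := exists_antideriv_mem_polyBelow h
  have hc : ∀ x y, (f - q) x = (f - q) y := by
    refine is_const_of_deriv_eq_zero (fun x => ((hf x).sub (hd x).differentiableAt)) fun x => ?_
    have := ((hf x).hasDerivAt.sub (hd x)).deriv
    simpa using this
  have : f = q + fun _ => (f - q) 0 := by
    ext x
    have := hc x 0
    simp only [Pi.sub_apply, Pi.add_apply] at this ⊢
    linarith
  rw [this]
  exact Submodule.add_mem _ hq (const_mem_polyBelow k _)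

theorem mem_polyBelow_of_iteratedDeriv (n : ℕ) : ∀ {k : ℕ} {f : ℝ → ℝ}, ContDiff ℝ n f →
    iteratedDeriv n f ∈ polyBelow k → f ∈ polyBelow (k + n) := by
  induction n with
  | zero => intro k f _ h; simpa using h
  | succ n ih =>
    intro k f hf h
    rw [iteratedDeriv_succ'] at h
    have hf' : ContDiff ℝ n (deriv f) := by
      have : ContDiff ℝ (n + 1) f := by exact_mod_cast hf
      exact (contDiff_succ_iff_deriv.1 this).2.2
    have hd : Differentiable ℝ f := hf.differentiable (by simp)
    exact mem_polyBelow_of_deriv hd (ih hf' h)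

theorem exists_polynomial_of_mem_polyBelow {k : ℕ} {f : ℝ → ℝ} (hf : f ∈ polyBelow k) :
    ∃ P : Polynomial ℝ, f = fun x => P.eval x := by
  induction hf using Submodule.span_induction with
  | mem p hp =>
    obtain ⟨i, rfl⟩ := hp
    exact ⟨Polynomial.X ^ (i : ℕ), by simp⟩
  | zero => exact ⟨0, by ext; simp⟩
  | add p₁ p₂ _ _ h₁ h₂ =>
    obtain ⟨P, rfl⟩ := h₁
    obtain ⟨Q, rfl⟩ := h₂
    exact ⟨P + Q, by ext; simp⟩
  | smul a p _ h =>
    obtain ⟨P, rfl⟩ := h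
    exact ⟨a • P, by ext; simp⟩

theorem eq_const_of_mem_polyBelow_of_bounded {k : ℕ} {f : ℝ → ℝ} (hf : f ∈ polyBelow k)
    {M : ℝ} (hM : ∀ x, |f x| ≤ M) : ∃ c, ∀ x, f x = c := by
  obtain ⟨P, rfl⟩ := exists_polynomial_of_mem_polyBelow hf
  have h : P.degree ≤ 0 :=
    P.isBoundedUnder_abs_atTop_iff.1 (isBoundedUnder_of ⟨M, hM⟩)
  rw [Polynomial.eq_C_of_degree_le_zero h]
  exact ⟨P.coeff 0, fun x => by simp⟩

/-! Density of ridge functions in the space of continuous functions -/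

theorem exists_mollification_iteratedDeriv_ne_zero {Φ : ℝ → ℝ} (hΦ : Continuous Φ) {k : ℕ}
    (hk : Φ ∉ polyBelow k) : ∃ (φ : ContDiffBump (0 : ℝ)) (c : ℝ),
      iteratedDeriv k (convolution (φ.normed volume) Φ (ContinuousLinearMap.lsmul ℝ ℝ) volume) c
        ≠ 0 := by
  by_contra! hcon
  apply hk
  let φ : ℕ → ContDiffBump (0 : ℝ) := fun n =>
    ⟨1 / ((n : ℝ) + 1) / 2, 1 / ((n : ℝ) + 1), by positivity, by
      have : (0 : ℝ) < 1 / ((n : ℝ) + 1) := by positivity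
      linarith⟩
  have hlim : Tendsto (fun n => convolution ((φ n).normed volume) Φ
      (ContinuousLinearMap.lsmul ℝ ℝ) volume) atTop (𝓝 Φ) := by
    rw [tendsto_pi_nhds]
    intro x
    exact ContDiffBump.convolution_tendsto_right_of_continuous
      tendsto_one_div_add_atTop_nhds_zero_nat hΦ x
  refine (isClosed_polyBelow k).mem_of_tendsto hlim (Eventually.of_forall fun n => ?_)
  have hs : ContDiff ℝ k (convolution ((φ n).normed volume) Φ
      (ContinuousLinearMap.lsmul ℝ ℝ) volume) :=
    (φ n).hasCompactSupport_normed.contDiff_convolution_left (n := (k : ℕ∞)) _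
      ((φ n).contDiff_normed) hΦ.locallyIntegrable
  have h0 : iteratedDeriv k (convolution ((φ n).normed volume) Φ
      (ContinuousLinearMap.lsmul ℝ ℝ) volume) ∈ polyBelow 0 := by
    have : iteratedDeriv k (convolution ((φ n).normed volume) Φ
      (ContinuousLinearMap.lsmul ℝ ℝ) volume) = 0 := funext fun c => hcon (φ n) c
    rw [this]
    exact Submodule.zero_mem _
  simpa using mem_polyBelow_of_iteratedDeriv k hs h0

/-- The ridge function `θ ↦ Φ (b θ + c)` on an interval. -/
def ridge (l u : ℝ) (Φ : C(ℝ, ℝ)) (b c : ℝ) : C(Icc l u, ℝ) :=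
  Φ.comp ⟨fun θ => b * (θ : ℝ) + c, by fun_prop⟩

/-- The closed span of the ridge functions with nonzero weight. -/
def ridgeClosure (l u : ℝ) (Φ : C(ℝ, ℝ)) : Submodule ℝ C(Icc l u, ℝ) :=
  (Submodule.span ℝ {f | ∃ b c : ℝ, b ≠ 0 ∧ f = ridge l u Φ b c}).topologicalClosure

theorem isClosed_ridgeClosure (l u : ℝ) (Φ : C(ℝ, ℝ)) :
    IsClosed (ridgeClosure l u Φ : Set C(Icc l u, ℝ)) :=
  Submodule.isClosed_topologicalClosure _

theorem ridge_mem_ridgeClosure (l u : ℝ) (Φ : C(ℝ, ℝ)) (b c : ℝ) :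
    ridge l u Φ b c ∈ ridgeClosure l u Φ := by
  have hcont : Continuous fun b => ridge l u Φ b c := by
    refine ContinuousMap.continuous_of_continuous_uncurry _ ?_
    change Continuous fun p : ℝ × Icc l u => Φ (p.1 * (p.2 : ℝ) + c)
    fun_prop
  have hsub : closure ({0}ᶜ : Set ℝ) ⊆
      (fun b => ridge l u Φ b c) ⁻¹' (ridgeClosure l u Φ : Set C(Icc l u, ℝ)) := by
    refine closure_minimal (fun b hb => ?_) ((isClosed_ridgeClosure l u Φ).preimage hcont)
    exact Submodule.le_topologicalClosure _ (Submodule.subset_span ⟨b, c, hb, rfl⟩)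
  exact hsub (by rw [(dense_compl_singleton (0 : ℝ)).closure_eq]; trivial)

theorem integral_mem_of_isClosed {E : Type*} [NormedAddCommGroup E] [NormedSpace ℝ E]
    [CompleteSpace E] {W : Submodule ℝ E} (hW : IsClosed (W : Set E)) {F : ℝ → E}
    (hF : Integrable F) (hmem : ∀ y, F y ∈ W) : ∫ y, F y ∈ W := by
  by_contra hx
  obtain ⟨g, u, hgu, hu⟩ := geometric_hahn_banach_closed_point (W.convex) hW hx
  have hz : ∀ w ∈ W, g w = 0 := by
    intro w hw
    by_contra hne
    have := hgu (((u + 1) / g w) • w) (W.smul_mem _ hw)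
    rw [map_smul, smul_eq_mul, div_mul_cancel₀ _ hne] at this
    linarith
  have h0 : 0 < u := by simpa using hgu 0 W.zero_mem
  rw [← g.integral_comp_comm hF] at hu
  simp only [hz _ (hmem _), integral_zero] at hu
  linarith

theorem ridge_mollification_mem_ridgeClosure (l u : ℝ) (Φ : C(ℝ, ℝ)) (φ : ContDiffBump (0 : ℝ))
    (ψ : C(ℝ, ℝ))
    (hψ : ∀ x, ψ x =
      convolution (φ.normed volume) Φ (ContinuousLinearMap.lsmul ℝ ℝ) volume x) (b c : ℝ) :
    ridge l u ψ b c ∈ ridgeClosure l u Φ := by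
  let F : ℝ → C(Icc l u, ℝ) := fun y => φ.normed volume y • ridge l u Φ b (c - y)
  have hcont : Continuous F := by
    refine φ.continuous_normed.smul ?_
    refine ContinuousMap.continuous_of_continuous_uncurry _ ?_
    change Continuous fun p : ℝ × Icc l u => Φ (b * (p.2 : ℝ) + (c - p.1))
    fun_prop
  have hF : Integrable F :=
    hcont.integrable_of_hasCompactSupport φ.hasCompactSupport_normed.smul_right
  have hmem := integral_mem_of_isClosed (isClosed_ridgeClosure l u Φ) hF
    fun y => Submodule.smul_mem _ _ (ridge_mem_ridgeClosure l u Φ b (c - y))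
  convert hmem using 1
  ext θ
  have := (ContinuousMap.evalCLM ℝ θ).integral_comp_comm hF
  simp only [ContinuousMap.evalCLM_apply] at this
  rw [← this]
  change ψ (b * θ + c) = _
  rw [hψ, convolution_def]
  refine integral_congr_ae (Eventually.of_forall fun y => ?_)
  simp [F, ridge, add_sub_assoc]

theorem deriv_mem_of_isClosed {l u : ℝ} {W : Submodule ℝ C(Icc l u, ℝ)}
    (hW : IsClosed (W : Set C(Icc l u, ℝ))) {F F' : ℝ → C(Icc l u, ℝ)} (hF' : Continuous F')
    (hd : ∀ b θ, HasDerivAt (fun b => F b θ) (F' b θ) b) (hmem : ∀ b, F b ∈ W) (b : ℝ) :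
    F' b ∈ W := by
  have hint : ∀ t, ∫ s in (0 : ℝ)..t, F' s = F t - F 0 := by
    intro t
    ext θ
    have hi : IntervalIntegrable F' volume 0 t := hF'.intervalIntegrable _ _
    have h1 := (ContinuousMap.evalCLM ℝ θ).intervalIntegral_comp_comm hi
    simp only [ContinuousMap.evalCLM_apply] at h1
    rw [← h1]
    have hc : Continuous fun s => F' s θ := (continuous_eval_const θ).comp hF'
    rw [intervalIntegral.integral_eq_sub_of_hasDerivAt (fun s _ => hd s θ)
      (hc.intervalIntegrable _ _)]
    rfl
  have hder : HasDerivAt (fun t => F t - F 0) (F' b) b := by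
    have := intervalIntegral.integral_hasDerivAt_right (hF'.intervalIntegrable 0 b)
      (hF'.stronglyMeasurableAtFilter _ _) hF'.continuousAt
    simpa only [hint] using this
  refine hW.mem_of_tendsto hder.tendsto_slope (Eventually.of_forall fun t => ?_)
  rw [slope_def_module]
  exact W.smul_mem _ (W.sub_mem (W.sub_mem (hmem _) (hmem _)) (W.sub_mem (hmem _) (hmem _)))

theorem pow_mul_iteratedDeriv_mem {l u : ℝ} {W : Submodule ℝ C(Icc l u, ℝ)}
    (hW : IsClosed (W : Set C(Icc l u, ℝ))) {ψ : ℝ → ℝ} (hψ : ∀ n : ℕ, ContDiff ℝ n ψ) (c : ℝ)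
    (hmem : ∀ b, ∃ f ∈ W, ∀ θ, f θ = ψ (b * (θ : ℝ) + c)) (k : ℕ) :
    ∀ b, ∃ f ∈ W, ∀ θ, f θ = (θ : ℝ) ^ k * iteratedDeriv k ψ (b * (θ : ℝ) + c) := by
  have hcd : ∀ k, Continuous (iteratedDeriv k ψ) := fun k =>
    (hψ k).continuous_iteratedDeriv k le_rfl
  have hdd : ∀ k x, HasDerivAt (iteratedDeriv k ψ) (iteratedDeriv (k + 1) ψ x) x := fun k x => by
    rw [iteratedDeriv_succ]
    exact ((hψ (k + 1)).differentiable_iteratedDeriv k (by exact_mod_cast k.lt_succ_self)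
      x).hasDerivAt
  induction k with
  | zero => simpa using hmem
  | succ k ih =>
    let F : ℕ → ℝ → C(Icc l u, ℝ) := fun k b =>
      ⟨fun θ => (θ : ℝ) ^ k * iteratedDeriv k ψ (b * (θ : ℝ) + c),
        by have := hcd k; fun_prop⟩
    have hFc : Continuous (F (k + 1)) := by
      refine ContinuousMap.continuous_of_continuous_uncurry _ ?_
      change Continuous fun p : ℝ × Icc l u =>
        ((p.2 : ℝ)) ^ (k + 1) * iteratedDeriv (k + 1) ψ (p.1 * (p.2 : ℝ) + c)
      have := hcd (k + 1)
      fun_prop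
    have hFm : ∀ b, F k b ∈ W := by
      intro b
      obtain ⟨f, hf, hfe⟩ := ih b
      convert hf using 1
      ext θ
      exact (hfe θ).symm
    intro b
    refine ⟨F (k + 1) b, deriv_mem_of_isClosed hW hFc (fun b θ => ?_) hFm b, fun θ => rfl⟩
    have h1 : HasDerivAt (fun b : ℝ => b * (θ : ℝ) + c) (θ : ℝ) b := by
      simpa using ((hasDerivAt_id b).mul_const (θ : ℝ)).add_const c
    have h2 := ((hdd k (b * (θ : ℝ) + c)).comp b h1).const_mul ((θ : ℝ) ^ k)
    refine h2.congr_deriv ?_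
    change _ = (θ : ℝ) ^ (k + 1) * iteratedDeriv (k + 1) ψ (b * (θ : ℝ) + c)
    ring

theorem ridgeClosure_eq_top (l u : ℝ) (Φ : C(ℝ, ℝ)) (hΦ : ∀ k, (Φ : ℝ → ℝ) ∉ polyBelow k) :
    ridgeClosure l u Φ = ⊤ := by
  have hpow : ∀ k : ℕ, ∃ f ∈ ridgeClosure l u Φ, ∀ θ, f θ = (θ : ℝ) ^ k := by
    intro k
    obtain ⟨φ, c, hc⟩ := exists_mollification_iteratedDeriv_ne_zero Φ.continuous (hΦ k)
    set ψ := convolution (φ.normed volume) Φ (ContinuousLinearMap.lsmul ℝ ℝ) volume with hψ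
    have hs : ∀ n : ℕ, ContDiff ℝ n ψ := fun n =>
      φ.hasCompactSupport_normed.contDiff_convolution_left (n := (n : ℕ∞)) _
        φ.contDiff_normed Φ.continuous.locallyIntegrable
    obtain ⟨f, hf, hfe⟩ := pow_mul_iteratedDeriv_mem (isClosed_ridgeClosure l u Φ) hs c
      (fun b => ⟨_, ridge_mollification_mem_ridgeClosure l u Φ φ ⟨ψ, (hs 0).continuous⟩
        (fun x => rfl) b c, fun θ => rfl⟩) k 0
    refine ⟨(iteratedDeriv k ψ c)⁻¹ • f, Submodule.smul_mem _ _ hf, fun θ => ?_⟩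
    rw [ContinuousMap.smul_apply, hfe, zero_mul, zero_add, smul_eq_mul]
    field_simp
  have hpoly : ∀ P : Polynomial ℝ, P.toContinuousMapOn (Icc l u) ∈ ridgeClosure l u Φ := by
    intro P
    choose f hf hfe using hpow
    have : P.toContinuousMapOn (Icc l u) = ∑ i ∈ Finset.range (P.natDegree + 1), P.coeff i • f i := by
      ext θ
      simp [Polynomial.eval_eq_sum_range, hfe, ContinuousMap.sum_apply]
    rw [this]
    exact Submodule.sum_mem _ fun i _ => Submodule.smul_mem _ _ (hf i)
  rw [eq_top_iff]
  intro g _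
  have hg : g ∈ (polynomialFunctions (Icc l u)).topologicalClosure := by
    rw [polynomialFunctions_closure_eq_top]; trivial
  have hsub : closure ((polynomialFunctions (Icc l u) : Set C(Icc l u, ℝ))) ⊆
      (ridgeClosure l u Φ : Set C(Icc l u, ℝ)) := by
    refine closure_minimal ?_ (isClosed_ridgeClosure l u Φ)
    rw [polynomialFunctions_coe]
    rintro _ ⟨P, rfl⟩
    exact hpoly P
  exact hsub hg

/-! Density of networks in `Cⁿ` -/

/-- The span of the functions `θ ↦ Φ (b θ + c)` with `b ≠ 0`. -/
def netSpan (Φ : ℝ → ℝ) : Submodule ℝ (ℝ → ℝ) :=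
  Submodule.span ℝ {f | ∃ b c : ℝ, b ≠ 0 ∧ f = fun θ => Φ (b * θ + c)}

/-- The span of `Φ (b θ + c)`, `b ≠ 0`, is dense in `Cⁿ` on the interval `[l, u]`. -/
def DenseNets (l u : ℝ) (n : ℕ) (Φ : ℝ → ℝ) : Prop :=
  ∀ f : ℝ → ℝ, ContDiff ℝ n f → ∀ ε > 0, ∃ ρ ∈ netSpan Φ, ∀ α ≤ n, ∀ θ ∈ Icc l u,
    |iteratedDeriv α ρ θ - iteratedDeriv α f θ| ≤ ε

theorem contDiff_of_mem_netSpan {n : ℕ} {Φ : ℝ → ℝ} (hΦ : ContDiff ℝ n Φ) {ρ : ℝ → ℝ}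
    (hρ : ρ ∈ netSpan Φ) : ContDiff ℝ n ρ := by
  induction hρ using Submodule.span_induction with
  | mem p hp =>
    obtain ⟨b, c, -, rfl⟩ := hp
    exact hΦ.comp ((contDiff_const.mul contDiff_id).add contDiff_const)
  | zero => exact contDiff_const
  | add p q _ _ hp hq => exact hp.add hq
  | smul a p _ hp => exact contDiff_const.smul hp

theorem exists_antideriv_mem_netSpan {Ψ : ℝ → ℝ} (hΨ : Differentiable ℝ Ψ) {ρ : ℝ → ℝ}
    (hρ : ρ ∈ netSpan (deriv Ψ)) : ∃ q ∈ netSpan Ψ, ∀ x, HasDerivAt q (ρ x) x := by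
  induction hρ using Submodule.span_induction with
  | mem p hp =>
    obtain ⟨b, c, hb, rfl⟩ := hp
    refine ⟨b⁻¹ • fun θ => Ψ (b * θ + c),
      Submodule.smul_mem _ _ (Submodule.subset_span ⟨b, c, hb, rfl⟩), fun x => ?_⟩
    have h1 : HasDerivAt (fun θ : ℝ => b * θ + c) b x := by
      simpa using ((hasDerivAt_id x).const_mul b).add_const c
    have h2 := (((hΨ (b * x + c)).hasDerivAt).comp x h1).const_smul b⁻¹
    refine h2.congr_deriv ?_
    rw [smul_eq_mul]
    field_simp
  | zero => exact ⟨0, Submodule.zero_mem _, fun x => hasDerivAt_const x 0⟩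
  | add p₁ p₂ _ _ h₁ h₂ =>
    obtain ⟨q₁, hq₁, hd₁⟩ := h₁
    obtain ⟨q₂, hq₂, hd₂⟩ := h₂
    exact ⟨q₁ + q₂, Submodule.add_mem _ hq₁ hq₂, fun x => (hd₁ x).add (hd₂ x)⟩
  | smul a p _ h =>
    obtain ⟨q, hq, hd⟩ := h
    exact ⟨a • q, Submodule.smul_mem _ _ hq, fun x => (hd x).const_smul a⟩

theorem denseNets_zero (l u : ℝ) {Φ : ℝ → ℝ} (hΦ : Continuous Φ)
    (hpoly : ∀ k, Φ ∉ polyBelow k) : DenseNets l u 0 Φ := by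
  intro f hf ε hε
  have hf : Continuous f := hf.continuous
  let f' : C(Icc l u, ℝ) := ⟨fun θ => f θ, by fun_prop⟩
  have hmem : f' ∈ ridgeClosure l u ⟨Φ, hΦ⟩ := by
    rw [ridgeClosure_eq_top l u ⟨Φ, hΦ⟩ hpoly]; trivial
  obtain ⟨g, hg, hd⟩ := Metric.mem_closure_iff.1 hmem ε hε
  have hlift : ∃ ρ ∈ netSpan Φ, ∀ θ : Icc l u, ρ θ = g θ := by
    clear hd
    change g ∈ Submodule.span ℝ _ at hg
    induction hg using Submodule.span_induction with
    | mem p hp =>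
      obtain ⟨b, c, hb, rfl⟩ := hp
      exact ⟨_, Submodule.subset_span ⟨b, c, hb, rfl⟩, fun θ => rfl⟩
    | zero => exact ⟨0, Submodule.zero_mem _, fun _ => rfl⟩
    | add p q _ _ hp hq =>
      obtain ⟨ρ₁, h₁, e₁⟩ := hp
      obtain ⟨ρ₂, h₂, e₂⟩ := hq
      exact ⟨ρ₁ + ρ₂, Submodule.add_mem _ h₁ h₂, fun θ => by simp [e₁, e₂]⟩
    | smul a p _ hp =>
      obtain ⟨ρ₁, h₁, e₁⟩ := hp
      exact ⟨a • ρ₁, Submodule.smul_mem _ _ h₁, fun θ => by simp [e₁]⟩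
  obtain ⟨ρ, hρ, he⟩ := hlift
  refine ⟨ρ, hρ, fun α hα θ hθ => ?_⟩
  obtain rfl : α = 0 := by omega
  simp only [iteratedDeriv_zero]
  have h1 := (ContinuousMap.dist_apply_le_dist (f := f') (g := g) ⟨θ, hθ⟩).trans hd.le
  rw [he ⟨θ, hθ⟩, ← Real.dist_eq, dist_comm]
  exact h1

theorem exists_netSpan_near_const (l u : ℝ) {n : ℕ} {Ψ : ℝ → ℝ} (hΨ : ContDiff ℝ n Ψ)
    {c : ℝ} (hc : Ψ c ≠ 0) (C : ℝ) {ε : ℝ} (hε : 0 < ε) :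
    ∃ ρ ∈ netSpan Ψ, ∀ α ≤ n, ∀ θ ∈ Icc l u,
      |iteratedDeriv α ρ θ - iteratedDeriv α (fun _ => C) θ| ≤ ε := by
  let κ : ℝ → ℝ → ℝ := fun b θ => C / Ψ c * Ψ (b * θ + c)
  have hκ : ∀ α ≤ n, ∀ b θ, iteratedDeriv α (κ b) θ
      = C / Ψ c * (b ^ α * iteratedDeriv α Ψ (b * θ + c)) := by
    intro α hα b θ
    have hs : ContDiff ℝ α (fun x => Ψ (x + c)) :=
      (hΨ.of_le (by exact_mod_cast hα)).comp (contDiff_id.add contDiff_const)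
    have h1 := congrFun (iteratedDeriv_comp_const_mul hs b) θ
    rw [show κ b = fun θ => C / Ψ c * (fun θ => (fun x => Ψ (x + c)) (b * θ)) θ from rfl,
      iteratedDeriv_const_mul_field, h1, iteratedDeriv_comp_add_const]
  have hev : ∀ α ∈ Finset.range (n + 1), ∀ᶠ b in 𝓝 (0 : ℝ), ∀ θ ∈ Icc l u,
      |iteratedDeriv α (κ b) θ - iteratedDeriv α (fun _ => C) θ| < ε := by
    intro α hα
    have hα' : α ≤ n := by simpa [Nat.lt_succ_iff] using hα
    refine isCompact_Icc.eventually_forall_of_forall_eventually fun θ _ => ?_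
    have hcont : Continuous fun p : ℝ × ℝ =>
        |C / Ψ c * (p.1 ^ α * iteratedDeriv α Ψ (p.1 * p.2 + c))
          - iteratedDeriv α (fun _ => C) θ| := by
      have := hΨ.continuous_iteratedDeriv α (by exact_mod_cast hα')
      fun_prop
    have h0 := hcont.tendsto (0, θ)
    have hval : |C / Ψ c * ((0 : ℝ) ^ α * iteratedDeriv α Ψ (0 * θ + c))
          - iteratedDeriv α (fun _ => C) θ| < ε := by
      rcases Nat.eq_zero_or_pos α with rfl | hpos
      · simp [hc, hε]
      · simp [iteratedDeriv_const, hpos.ne', hε]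
    filter_upwards [h0.eventually_lt_const hval] with p hp
    rw [hκ α hα']
    simpa [iteratedDeriv_const] using hp
  have hall := (Filter.eventually_all_finset (Finset.range (n + 1))).2 hev
  have hne : ∃ b : ℝ, b ≠ 0 ∧ ∀ α ∈ Finset.range (n + 1), ∀ θ ∈ Icc l u,
      |iteratedDeriv α (κ b) θ - iteratedDeriv α (fun _ => C) θ| < ε := by
    have := (hall.filter_mono nhdsWithin_le_nhds : ∀ᶠ b in 𝓝[≠] (0 : ℝ), _)
    exact (this.and self_mem_nhdsWithin).exists.imp fun b hb => ⟨hb.2, hb.1⟩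
  obtain ⟨b, hb, h⟩ := hne
  exact ⟨κ b, Submodule.smul_mem _ (C / Ψ c) (Submodule.subset_span ⟨b, c, hb, rfl⟩),
    fun α hα θ hθ => (h α (by simp; omega) θ hθ).le⟩

theorem DenseNets.of_deriv {l u : ℝ} (hlu : l ≤ u) {n : ℕ} {Ψ : ℝ → ℝ}
    (hΨ : ContDiff ℝ (n + 1 : ℕ) Ψ) (h : DenseNets l u n (deriv Ψ)) :
    DenseNets l u (n + 1) Ψ := by
  have hd : Differentiable ℝ Ψ := hΨ.differentiable (by simp)
  obtain ⟨c, hc⟩ : ∃ c, Ψ c ≠ 0 := by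
    by_contra! h0
    have hz : Ψ = fun _ => 0 := funext h0
    obtain ⟨ρ, hρ, hρ1⟩ := h (fun _ => 1) contDiff_const (1 / 2) (by norm_num)
    have hρ0 : ρ = 0 := by
      have hsub : netSpan (deriv Ψ) ≤ ⊥ := by
        refine Submodule.span_le.2 ?_
        rintro _ ⟨b, c, -, rfl⟩
        simp only [SetLike.mem_coe, Submodule.mem_bot, hz]
        ext
        simp
      simpa using hsub hρ
    have := hρ1 0 (Nat.zero_le _) l ⟨le_rfl, hlu⟩
    simp [hρ0] at this
    norm_num at this
  intro f hf ε hε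
  have hf' : ContDiff ℝ n (deriv f) := by
    have : ContDiff ℝ (n + 1) f := by exact_mod_cast hf
    exact (contDiff_succ_iff_deriv.1 this).2.2
  have hfd : Differentiable ℝ f := hf.differentiable (by simp)
  set η := ε / (2 * (u - l + 1)) with hη
  have hη0 : 0 < η := by have : 0 < u - l + 1 := by linarith
                         positivity
  have hη1 : η * (u - l) ≤ ε / 2 ∧ η ≤ ε / 2 := by
    have h1 : η * (u - l + 1) = ε / 2 := by
      have : u - l + 1 ≠ 0 := by linarith
      rw [hη]; field_simp
    constructor <;> nlinarith
  obtain ⟨ρ₁, hρ₁, hρ₁'⟩ := h (deriv f) hf' η hη0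
  obtain ⟨q, hq, hqd⟩ := exists_antideriv_mem_netSpan hd hρ₁
  obtain ⟨κ, hκ, hκ'⟩ := exists_netSpan_near_const l u hΨ hc (f l - q l) (half_pos hε)
  have hdq : deriv q = ρ₁ := funext fun x => (hqd x).deriv
  refine ⟨q + κ, Submodule.add_mem _ hq hκ, fun α hα θ hθ => ?_⟩
  have hcq : ContDiff ℝ α q := (contDiff_of_mem_netSpan hΨ hq).of_le (by exact_mod_cast hα)
  have hcκ : ContDiff ℝ α κ := (contDiff_of_mem_netSpan hΨ hκ).of_le (by exact_mod_cast hα)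
  rw [iteratedDeriv_add hcq.contDiffAt hcκ.contDiffAt]
  have hk := hκ' α hα θ hθ
  rcases α with _ | α
  · simp only [iteratedDeriv_zero] at hk ⊢
    have hmv := (convex_Icc l u).norm_image_sub_le_of_norm_hasDerivWithin_le
      (f := q - f) (f' := fun x => ρ₁ x - deriv f x) (C := η)
      (fun x _ => ((hqd x).sub (hfd x).hasDerivAt).hasDerivWithinAt)
      (fun x hx => by simpa using hρ₁' 0 (Nat.zero_le _) x hx) ⟨le_rfl, hlu⟩ hθ
    simp only [Pi.sub_apply, Real.norm_eq_abs] at hmv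
    rw [abs_of_nonneg (by linarith [hθ.1] : 0 ≤ θ - l)] at hmv
    have h2 : η * (θ - l) ≤ η * (u - l) :=
      mul_le_mul_of_nonneg_left (by linarith [hθ.2]) hη0.le
    rw [abs_le] at hmv hk ⊢
    constructor <;> linarith [hη1.1, hmv.1, hmv.2, hk.1, hk.2]
  · have hp := hρ₁' α (by omega) θ hθ
    rw [iteratedDeriv_const, if_neg (by omega)] at hk
    rw [iteratedDeriv_succ' (f := q), iteratedDeriv_succ' (f := f), hdq]
    rw [abs_le] at hp hk ⊢
    constructor <;> linarith [hη1.2, hp.1, hp.2, hk.1, hk.2]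

theorem denseNets_of_iteratedDeriv {l u : ℝ} (hlu : l ≤ u) (n : ℕ) : ∀ {Ψ : ℝ → ℝ},
    ContDiff ℝ n Ψ → (∀ k, iteratedDeriv n Ψ ∉ polyBelow k) → DenseNets l u n Ψ := by
  induction n with
  | zero =>
    intro Ψ hΨ h
    exact denseNets_zero l u hΨ.continuous (by simpa using h)
  | succ n ih =>
    intro Ψ hΨ h
    have hΨ' : ContDiff ℝ n (deriv Ψ) := by
      have : ContDiff ℝ (n + 1) Ψ := by exact_mod_cast hΨ
      exact (contDiff_succ_iff_deriv.1 this).2.2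
    exact DenseNets.of_deriv hlu hΨ (ih hΨ' (by simpa only [iteratedDeriv_succ'] using h))

/-- Networks with a bounded nonconstant `Cⁿ` activation are dense in `Cⁿ` on compact intervals. -/
theorem denseNets_of_bounded {l u : ℝ} (hlu : l ≤ u) {n : ℕ} {Ψ : ℝ → ℝ} (hΨ : ContDiff ℝ n Ψ)
    (hb : ∃ M : ℝ, ∀ x, |Ψ x| ≤ M) (hc : ¬ ∃ c : ℝ, ∀ x, Ψ x = c) : DenseNets l u n Ψ := by
  obtain ⟨M, hM⟩ := hb
  exact denseNets_of_iteratedDeriv hlu n hΨ fun k hk =>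
    hc (eq_const_of_mem_polyBelow_of_bounded (mem_polyBelow_of_iteratedDeriv n hΨ hk) hM)

theorem exists_mem_networks_of_mem_netSpan {Ψ ρ : ℝ → ℝ} (hρ : ρ ∈ netSpan Ψ) :
    ∃ N : ℕ, 1 ≤ N ∧ ρ ∈ networks Ψ N := by
  obtain ⟨n, a, g, hg⟩ := Submodule.mem_span_set'.1 hρ
  choose b c _ hbc using fun i => (g i).2
  refine ⟨n + 1, by omega, Fin.cons 0 a, Fin.cons 0 b, Fin.cons 0 c, 0, ?_⟩
  ext θ
  rw [← hg]
  simp [Fin.sum_univ_succ, hbc]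

/-! Entire series -/

/-- The function with power series coefficients `c`. -/
def series (c : ℕ → ℝ) (t : ℝ) : ℝ := ∑' k, c k * t ^ k

/-- The coefficients of the derivative. -/
def shiftCoeff (c : ℕ → ℝ) (k : ℕ) : ℝ := (k + 1) * c (k + 1)

/-- Coefficients dominated by those of the exponential series. -/
def ExpBounded (c : ℕ → ℝ) : Prop := ∀ k, |c k| ≤ 1 / (k.factorial : ℝ)

theorem ExpBounded.shift {c : ℕ → ℝ} (h : ExpBounded c) : ExpBounded (shiftCoeff c) := by
  intro k
  have h1 := h (k + 1)
  have hk : (0 : ℝ) < (k : ℝ) + 1 := by positivity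
  rw [shiftCoeff, abs_mul, abs_of_pos hk]
  calc ((k : ℝ) + 1) * |c (k + 1)| ≤ ((k : ℝ) + 1) * (1 / ((k + 1).factorial : ℝ)) := by gcongr
    _ = 1 / (k.factorial : ℝ) := by
      rw [Nat.factorial_succ]; push_cast
      have : (k.factorial : ℝ) ≠ 0 := by positivity
      field_simp

theorem ExpBounded.summable {c : ℕ → ℝ} (h : ExpBounded c) (t : ℝ) :
    Summable fun k => c k * t ^ k := by
  refine Summable.of_norm_bounded (g := fun k => |t| ^ k / (k.factorial : ℝ))
    (Real.summable_pow_div_factorial |t|) fun k => ?_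
  rw [norm_mul, norm_pow, Real.norm_eq_abs, Real.norm_eq_abs, div_eq_inv_mul, inv_eq_one_div]
  gcongr
  exact h k

theorem ExpBounded.hasDerivAt {c : ℕ → ℝ} (h : ExpBounded c) (t : ℝ) :
    HasDerivAt (series c) (series (shiftCoeff c) t) t := by
  set T := |t| + 1
  have hu : Summable fun k : ℕ => (k : ℝ) * (1 / (k.factorial : ℝ)) * T ^ (k - 1) := by
    refine (summable_nat_add_iff 1).1 ?_
    refine (Real.summable_pow_div_factorial T).congr fun k => ?_
    rw [Nat.factorial_succ]; push_cast
    have : (k.factorial : ℝ) ≠ 0 := by positivity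
    have : (k : ℝ) + 1 ≠ 0 := by positivity
    field_simp
  have hd := hasDerivAt_tsum_of_isPreconnected (g := fun k s => c k * s ^ k)
    (g' := fun k s => c k * (k * s ^ (k - 1))) (t := Ioo (-T) T) (y₀ := 0) (y := t) hu isOpen_Ioo
    isPreconnected_Ioo (fun k s _ => (hasDerivAt_pow k s).const_mul (c k)) (fun k s hs => by
      rw [norm_mul, norm_mul, norm_pow, Real.norm_eq_abs, Real.norm_eq_abs, Real.norm_eq_abs,
        abs_of_nonneg (Nat.cast_nonneg k : (0 : ℝ) ≤ k), mul_left_comm, mul_assoc]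
      have h1 := h k
      have h2 : |s| ≤ T := (abs_lt.2 hs).le
      gcongr)
    ⟨by have := abs_nonneg t; simp only [T]; linarith, by have := abs_nonneg t; simp only [T]; linarith⟩
    (h.summable 0) (by constructor <;> simp only [T] <;> linarith [neg_abs_le t, le_abs_self t])
  refine hd.congr_deriv ?_
  have hsum : Summable fun k => c k * (k * t ^ (k - 1)) := by
    refine (summable_nat_add_iff 1).1 ?_
    refine (h.shift.summable t).congr fun k => ?_
    simp only [shiftCoeff, Nat.add_sub_cancel]
    push_cast
    ring
  rw [hsum.tsum_eq_zero_add, series]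
  simp only [Nat.cast_zero, zero_mul, mul_zero, zero_add, Nat.add_sub_cancel]
  refine tsum_congr fun k => ?_
  simp only [shiftCoeff]
  push_cast
  ring

theorem ExpBounded.continuous {c : ℕ → ℝ} (h : ExpBounded c) : Continuous (series c) :=
  continuous_iff_continuousAt.2 fun t => (h.hasDerivAt t).continuousAt

theorem ExpBounded.series_eq {c : ℕ → ℝ} (h : ExpBounded c) (t : ℝ) :
    series c t = c 0 + t * series (fun k => c (k + 1)) t := by
  rw [series, (h.summable t).tsum_eq_zero_add, series, ← tsum_mul_left]
  simp only [pow_zero, mul_one]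
  congr 1
  exact tsum_congr fun k => by ring

/-! The Green function in the variable `t = r² / 4` -/

/-- Coefficients of `I₀` in the variable `r² / 4`. -/
def coeffA (k : ℕ) : ℝ := 1 / (k.factorial : ℝ) ^ 2

/-- Coefficients of the regular part of the Green function in the variable `r² / 4`. -/
def coeffB (k : ℕ) : ℝ := ((harmonic k : ℚ) : ℝ) / (k.factorial : ℝ) ^ 2

theorem harmonic_nonneg (k : ℕ) : 0 ≤ ((harmonic k : ℚ) : ℝ) := by
  have : (0 : ℚ) ≤ harmonic k := Finset.sum_nonneg fun i _ => by positivity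
  exact_mod_cast this

theorem harmonic_le (k : ℕ) : ((harmonic k : ℚ) : ℝ) ≤ k := by
  induction k with
  | zero => simp
  | succ k ih =>
    rw [harmonic_succ]; push_cast
    have : ((k : ℝ) + 1)⁻¹ ≤ 1 := inv_le_one_of_one_le₀ (by linarith [Nat.cast_nonneg (α := ℝ) k])
    linarith

theorem expBounded_coeffA : ExpBounded coeffA := by
  intro k
  have h1 : (1 : ℝ) ≤ k.factorial := by exact_mod_cast k.factorial_pos
  rw [coeffA, abs_of_nonneg (by positivity)]
  gcongr
  nlinarith

theorem expBounded_coeffB : ExpBounded coeffB := by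
  intro k
  have h0 : (0 : ℝ) < k.factorial := by positivity
  have h1 : (k : ℝ) ≤ k.factorial := by exact_mod_cast k.self_le_factorial
  rw [coeffB, abs_of_nonneg (div_nonneg (harmonic_nonneg k) (by positivity)),
    div_le_div_iff₀ (by positivity) h0]
  nlinarith [harmonic_le k]

theorem expBounded_coeffA_succ : ExpBounded fun k => coeffA (k + 1) := by
  intro k
  refine (expBounded_coeffA (k + 1)).trans ?_
  have : (k.factorial : ℝ) ≤ (k + 1).factorial := by exact_mod_cast Nat.factorial_le (Nat.le_succ k)
  gcongr

theorem series_bessel_eq (c : ℕ → ℝ) (t : ℝ) (hc : ExpBounded c) :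
    t * series (shiftCoeff (shiftCoeff c)) t + series (shiftCoeff c) t
      = series (fun k => ((k : ℝ) + 1) ^ 2 * c (k + 1)) t := by
  have h1 := hc.shift.shift.summable t
  have h2 := hc.shift.summable t
  have h3 : Summable fun k : ℕ => (k : ℝ) * shiftCoeff c k * t ^ k := by
    refine (summable_nat_add_iff 1).1 ((h1.mul_left t).congr fun k => ?_)
    simp only [shiftCoeff]; push_cast; ring
  have h4 : t * series (shiftCoeff (shiftCoeff c)) t
      = ∑' k : ℕ, (k : ℝ) * shiftCoeff c k * t ^ k := by
    rw [h3.tsum_eq_zero_add, series, ← tsum_mul_left]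
    simp only [Nat.cast_zero, zero_mul, zero_add]
    refine tsum_congr fun k => ?_
    simp only [shiftCoeff]; push_cast; ring
  rw [h4, series, series, ← h3.tsum_add h2]
  refine tsum_congr fun k => ?_
  simp only [shiftCoeff]; ring

theorem bessel_ode_A (t : ℝ) :
    t * series (shiftCoeff (shiftCoeff coeffA)) t + series (shiftCoeff coeffA) t
      = series coeffA t := by
  rw [series_bessel_eq _ _ expBounded_coeffA]
  refine tsum_congr fun k => ?_
  simp only [coeffA, Nat.factorial_succ]
  push_cast
  have : (k.factorial : ℝ) ≠ 0 := by positivity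
  field_simp

theorem bessel_ode_B (t : ℝ) :
    t * series (shiftCoeff (shiftCoeff coeffB)) t + series (shiftCoeff coeffB) t
      = series coeffB t + series (shiftCoeff coeffA) t := by
  rw [series_bessel_eq _ _ expBounded_coeffB, series, series, series,
    ← (expBounded_coeffB.summable t).tsum_add (expBounded_coeffA.shift.summable t)]
  refine tsum_congr fun k => ?_
  simp only [coeffA, coeffB, shiftCoeff, Nat.factorial_succ, harmonic_succ]
  push_cast
  have : (k.factorial : ℝ) ≠ 0 := by positivity
  field_simp

/-- The function `log t · a(t) + b(t)`. -/
def logSeries (a b : ℕ → ℝ) (t : ℝ) : ℝ := Real.log t * series a t + series b t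

theorem hasDerivAt_logSeries {a b : ℕ → ℝ} (ha : ExpBounded a) (hb : ExpBounded b) {t : ℝ}
    (ht : 0 < t) : HasDerivAt (logSeries a b)
      (series a t / t + logSeries (shiftCoeff a) (shiftCoeff b) t) t := by
  refine (((Real.hasDerivAt_log ht.ne').mul (ha.hasDerivAt t)).add (hb.hasDerivAt t)).congr_deriv ?_
  rw [logSeries]
  field_simp
  ring

/-- The Green function as a function of `t = r² / 4`. -/
def greenT (t : ℝ) : ℝ :=
  -(1 / (4 * Real.pi)) * (logSeries coeffA (fun _ => 0) t
    + 2 * Real.eulerMascheroniConstant * series coeffA t - 2 * series coeffB t)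

/-- The derivative of `greenT`. -/
def greenT' (t : ℝ) : ℝ :=
  -(1 / (4 * Real.pi)) * (series coeffA t / t + logSeries (shiftCoeff coeffA) (fun _ => 0) t
    + 2 * Real.eulerMascheroniConstant * series (shiftCoeff coeffA) t
    - 2 * series (shiftCoeff coeffB) t)

/-- The second derivative of `greenT`. -/
def greenT'' (t : ℝ) : ℝ := (greenT t - greenT' t) / t

theorem expBounded_zero : ExpBounded fun _ => 0 := fun k => by
  rw [abs_zero]; positivity

theorem shiftCoeff_zero : shiftCoeff (fun _ => 0) = fun _ => 0 := by
  ext k; simp [shiftCoeff]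

theorem series_zero (t : ℝ) : series (fun _ => 0) t = 0 := by simp [series]

theorem hasDerivAt_greenT {t : ℝ} (ht : 0 < t) : HasDerivAt greenT (greenT' t) t := by
  have h1 := hasDerivAt_logSeries expBounded_coeffA expBounded_zero ht
  rw [shiftCoeff_zero] at h1
  exact ((h1.add ((expBounded_coeffA.hasDerivAt t).const_mul
    (2 * Real.eulerMascheroniConstant))).sub ((expBounded_coeffB.hasDerivAt t).const_mul 2)).const_mul
      (-(1 / (4 * Real.pi)))

theorem hasDerivAt_greenT' {t : ℝ} (ht : 0 < t) : HasDerivAt greenT' (greenT'' t) t := by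
  have h1 := hasDerivAt_logSeries expBounded_coeffA.shift expBounded_zero ht
  rw [shiftCoeff_zero] at h1
  have h2 := ((((expBounded_coeffA.hasDerivAt t).div (hasDerivAt_id t) ht.ne').add h1).add
    ((expBounded_coeffA.shift.hasDerivAt t).const_mul
    (2 * Real.eulerMascheroniConstant))).sub ((expBounded_coeffB.shift.hasDerivAt t).const_mul 2)
  refine (h2.const_mul (-(1 / (4 * Real.pi)))).congr_deriv ?_
  have hA := bessel_ode_A t
  have hB := bessel_ode_B t
  have hpi := Real.pi_ne_zero
  have ht' := ht.ne'
  simp only [greenT'', greenT, greenT', logSeries, series_zero, id]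
  field_simp
  linear_combination (-(Real.log t) - 2 * Real.eulerMascheroniConstant) * t * hA + 2 * t * hB

theorem greenT_ode {t : ℝ} (ht : 0 < t) : t * greenT'' t + greenT' t = greenT t := by
  rw [greenT'']
  field_simp
  ring

theorem greenG_eq {r : ℝ} (hr : 0 < r) : greenG r = greenT (r ^ 2 / 4) := by
  have hI : Complex.I ^ 2 = -1 := Complex.I_sq
  have hJ : besselJ0 (Complex.I * (r : ℂ)) = ((series coeffA (r ^ 2 / 4) : ℝ) : ℂ) := by
    rw [besselJ0, series, Complex.ofReal_tsum]
    refine tsum_congr fun k => ?_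
    simp only [coeffA]
    push_cast
    rw [mul_pow, hI, ← mul_pow, one_div_mul_eq_div]
    congr 2
    ring
  have hS : (∑' k : ℕ, (-1 : ℂ) ^ k * ((harmonic k : ℚ) : ℂ) * ((Complex.I * (r : ℂ)) ^ 2 / 4) ^ k
        / ((k.factorial : ℂ) ^ 2)) = ((series coeffB (r ^ 2 / 4) : ℝ) : ℂ) := by
    rw [series, Complex.ofReal_tsum]
    refine tsum_congr fun k => ?_
    simp only [coeffB]
    push_cast
    rw [mul_pow, hI, mul_right_comm, ← mul_pow, mul_comm (_ ^ k), div_mul_eq_mul_div]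
    congr 3
    ring
  have hL : Complex.log (Complex.I * (r : ℂ) / 2)
      = ((Real.log (r ^ 2 / 4) / 2 : ℝ) : ℂ) + (Real.pi : ℂ) / 2 * Complex.I := by
    have h2 : Complex.I * (r : ℂ) / 2 = ((r / 2 : ℝ) : ℂ) * Complex.I := by push_cast; ring
    have h3 : Real.log (r ^ 2 / 4) / 2 = Real.log (r / 2) := by
      rw [show r ^ 2 / 4 = (r / 2) ^ 2 by ring, Real.log_pow]; push_cast; ring
    rw [h3, h2, Complex.log_ofReal_mul (by positivity) Complex.I_ne_zero, Complex.log_I]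
  have key : Complex.I / 4 * hankelH0 (Complex.I * (r : ℂ))
      = ((greenT (r ^ 2 / 4) : ℝ) : ℂ) := by
    rw [hankelH0, besselY0, hS, hJ, hL, greenT, logSeries, series_zero]
    have hpi : (Real.pi : ℂ) ≠ 0 := by exact_mod_cast Real.pi_ne_zero
    push_cast
    field_simp
    ring_nf
    simp only [Complex.I_sq, show Complex.I ^ 3 = -Complex.I by
      rw [pow_succ, Complex.I_sq]; ring]
    ring
  rw [greenG, key, Complex.ofReal_re]

/-- The kernel `Q` as a function of `t = r² / 4`. -/
def kernelT (t : ℝ) : ℝ := (greenT' t + 1 / (4 * Real.pi * t)) / 2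

theorem kernelQ_eq {r : ℝ} (hr : 0 < r) : kernelQ r = kernelT (r ^ 2 / 4) := by
  have hd : HasDerivAt greenG (greenT' (r ^ 2 / 4) * (r / 2)) r := by
    have h1 : HasDerivAt (fun r : ℝ => r ^ 2 / 4) (r / 2) r := by
      refine ((hasDerivAt_pow 2 r).div_const 4).congr_deriv ?_
      norm_num; ring
    have h2 := (hasDerivAt_greenT (t := r ^ 2 / 4) (by positivity)).comp r h1
    refine h2.congr_of_eventuallyEq ?_
    filter_upwards [lt_mem_nhds hr] with s hs using greenG_eq hs
  have hpi := Real.pi_ne_zero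
  rw [kernelQ, hd.deriv, kernelT]
  field_simp

theorem kernelT_eq {t : ℝ} (ht : 0 < t) : kernelT t =
    -(1 / (8 * Real.pi)) * (series (fun k => coeffA (k + 1)) t
      + logSeries (shiftCoeff coeffA) (fun _ => 0) t
      + 2 * Real.eulerMascheroniConstant * series (shiftCoeff coeffA) t
      - 2 * series (shiftCoeff coeffB) t) := by
  have h := expBounded_coeffA.series_eq t
  have h0 : coeffA 0 = 1 := by simp [coeffA]
  have hpi := Real.pi_ne_zero
  rw [kernelT, greenT', h, h0]
  field_simp
  ring

/-! Logarithmic singularities -/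

/-- `f` has at most a logarithmic singularity at `0`: it is `log t · a(t) + b(t)` on `t > 0`, with
`a` and `b` locally Lipschitz. -/
def LogSingular (f : ℝ → ℝ) : Prop :=
  ∃ a b : ℝ → ℝ, ContDiff ℝ 1 a ∧ ContDiff ℝ 1 b ∧ ∀ t > 0, f t = Real.log t * a t + b t

theorem ExpBounded.contDiff {c : ℕ → ℝ} (h : ExpBounded c) : ContDiff ℝ 1 (series c) := by
  rw [contDiff_one_iff_deriv]
  refine ⟨fun t => (h.hasDerivAt t).differentiableAt, ?_⟩
  rw [show deriv (series c) = series (shiftCoeff c) from funext fun t => (h.hasDerivAt t).deriv]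
  exact h.shift.continuous

theorem logSingular_greenT : LogSingular greenT := by
  refine ⟨fun t => -(1 / (4 * Real.pi)) * series coeffA t,
    fun t => -(1 / (4 * Real.pi)) * (2 * Real.eulerMascheroniConstant * series coeffA t
      - 2 * series coeffB t), ?_, ?_, fun t _ => ?_⟩
  · exact contDiff_const.mul expBounded_coeffA.contDiff
  · exact contDiff_const.mul ((contDiff_const.mul expBounded_coeffA.contDiff).sub
      (contDiff_const.mul expBounded_coeffB.contDiff))
  · rw [greenT, logSeries, series_zero]; ring

theorem logSingular_kernelT : LogSingular kernelT := by
  refine ⟨fun t => -(1 / (8 * Real.pi)) * series (shiftCoeff coeffA) t,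
    fun t => -(1 / (8 * Real.pi)) * (series (fun k => coeffA (k + 1)) t
      + 2 * Real.eulerMascheroniConstant * series (shiftCoeff coeffA) t
      - 2 * series (shiftCoeff coeffB) t), ?_, ?_, fun t ht => ?_⟩
  · exact contDiff_const.mul expBounded_coeffA.shift.contDiff
  · exact contDiff_const.mul ((expBounded_coeffA_succ.contDiff.add
      (contDiff_const.mul expBounded_coeffA.shift.contDiff)).sub
      (contDiff_const.mul expBounded_coeffB.shift.contDiff))
  · rw [kernelT_eq ht, logSeries, series_zero]; ring

theorem LogSingular.continuousOn {f : ℝ → ℝ} (hf : LogSingular f) : ContinuousOn f (Ioi 0) := by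
  obtain ⟨a, b, ha, hb, h⟩ := hf
  refine ContinuousOn.congr (f := fun t => Real.log t * a t + b t) ?_ fun t ht => h t ht
  refine ContinuousOn.add (ContinuousOn.mul ?_ ha.continuous.continuousOn) hb.continuous.continuousOn
  exact Real.continuousOn_log.mono fun t ht => (ne_of_gt ht : t ≠ 0)

theorem abs_log_le_rpow {t T : ℝ} (ht : 0 < t) (htT : t ≤ T) :
    |Real.log t| ≤ 4 * (T ^ (1 / 2 : ℝ) + 1) * t ^ (-(1 / 4) : ℝ) := by
  have h1 := Real.log_le_rpow_div ht.le (show (0 : ℝ) < 1 / 4 by norm_num)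
  have h2 := Real.log_le_rpow_div (inv_nonneg.2 ht.le) (show (0 : ℝ) < 1 / 4 by norm_num)
  rw [Real.log_inv, Real.inv_rpow ht.le, ← Real.rpow_neg ht.le] at h2
  have h3 : t ^ (1 / 4 : ℝ) ≤ T ^ (1 / 2 : ℝ) * t ^ (-(1 / 4) : ℝ) := by
    have : t ^ (1 / 4 : ℝ) = t ^ (1 / 2 : ℝ) * t ^ (-(1 / 4) : ℝ) := by
      rw [← Real.rpow_add ht]; norm_num
    rw [this]
    gcongr
  have h4 : 0 < t ^ (-(1 / 4) : ℝ) := by positivity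
  have h5 : 0 ≤ T ^ (1 / 2 : ℝ) * t ^ (-(1 / 4) : ℝ) := by
    have : 0 < T := ht.trans_le htT
    positivity
  rw [abs_le]
  constructor <;> nlinarith

theorem log_one_add_le_rpow {x : ℝ} (hx : 0 ≤ x) : Real.log (1 + x) ≤ 4 * x ^ (1 / 4 : ℝ) := by
  set y := x ^ (1 / 4 : ℝ) with hy
  have hy0 : 0 ≤ y := by positivity
  have hxy : x = y ^ 4 := by
    rw [hy, ← Real.rpow_natCast, ← Real.rpow_mul hx]; norm_num
  have h1 : 1 + x ≤ (1 + y) ^ 4 := by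
    rw [hxy]; nlinarith [pow_nonneg hy0 2, pow_nonneg hy0 3]
  calc Real.log (1 + x) ≤ Real.log ((1 + y) ^ 4) := Real.log_le_log (by linarith) h1
    _ = 4 * Real.log (1 + y) := by rw [Real.log_pow]; norm_num
    _ ≤ 4 * y := by
      have := Real.log_le_sub_one_of_pos (show 0 < 1 + y by linarith)
      linarith

theorem LogSingular.exists_bound {f : ℝ → ℝ} (hf : LogSingular f) {T : ℝ} (hT : 0 < T) :
    ∃ C : ℝ, 0 ≤ C ∧ (∀ t, 0 < t → t ≤ T → |f t| ≤ C * t ^ (-(1 / 4) : ℝ)) ∧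
      ∀ t h, 0 < t → 0 < h → t + h ≤ T → |f (t + h) - f t| ≤ C * (h / t) ^ (1 / 4 : ℝ) := by
  obtain ⟨a, b, ha, hb, hfe⟩ := hf
  obtain ⟨Ma, hMa⟩ := isCompact_Icc.exists_bound_of_continuousOn
    (ha.continuous.continuousOn (s := Icc 0 T))
  obtain ⟨Mb, hMb⟩ := isCompact_Icc.exists_bound_of_continuousOn
    (hb.continuous.continuousOn (s := Icc 0 T))
  obtain ⟨La, hLa⟩ := ha.contDiffOn.exists_lipschitzOnWith one_ne_zero (convex_Icc 0 T)
    isCompact_Icc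
  obtain ⟨Lb, hLb⟩ := hb.contDiffOn.exists_lipschitzOnWith one_ne_zero (convex_Icc 0 T)
    isCompact_Icc
  have hMa0 : 0 ≤ Ma := (norm_nonneg _).trans (hMa 0 ⟨le_rfl, hT.le⟩)
  have hMb0 : 0 ≤ Mb := (norm_nonneg _).trans (hMb 0 ⟨le_rfl, hT.le⟩)
  set B := 4 * (T ^ (1 / 2 : ℝ) + 1) with hB
  have hB0 : 0 ≤ B := by positivity
  set w := T ^ (1 / 4 : ℝ) with hw
  have hw0 : 0 ≤ w := by positivity
  have hroot : ∀ t : ℝ, 0 < t → t ≤ T → 0 < t ^ (1 / 4 : ℝ) ∧ t ^ (1 / 4 : ℝ) ≤ w ∧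
      (t ^ (1 / 4 : ℝ)) ^ 4 = t := by
    intro t ht htT
    refine ⟨by positivity, by rw [hw]; gcongr, ?_⟩
    rw [← Real.rpow_natCast, ← Real.rpow_mul ht.le]; norm_num
  refine ⟨(B * Ma + w * Mb) + (4 * Ma + B * La * w ^ 3 + Lb * w ^ 4), by positivity, ?_, ?_⟩
  · intro t ht htT
    obtain ⟨hu0, huw, hu4⟩ := hroot t ht htT
    have hneg : t ^ (-(1 / 4) : ℝ) = (t ^ (1 / 4 : ℝ))⁻¹ := Real.rpow_neg ht.le _
    have hlog := abs_log_le_rpow ht htT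
    rw [hneg] at hlog ⊢
    set u := t ^ (1 / 4 : ℝ)
    have h1 := hMa t ⟨ht.le, htT⟩
    have h2 := hMb t ⟨ht.le, htT⟩
    rw [Real.norm_eq_abs] at h1 h2
    have h3 : (1 : ℝ) ≤ w * u⁻¹ := by
      rw [← div_eq_mul_inv, le_div_iff₀ hu0]; linarith
    calc |f t| ≤ |Real.log t| * |a t| + |b t| := by
          rw [hfe t ht, ← abs_mul]; exact abs_add_le _ _
      _ ≤ (B * u⁻¹) * Ma + Mb * (w * u⁻¹) := by
          gcongr
          exact h2.trans (le_mul_of_one_le_right hMb0 h3)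
      _ ≤ _ := by
          have : 0 ≤ (4 * Ma + B * La * w ^ 3 + Lb * w ^ 4) * u⁻¹ := by positivity
          linarith
  · intro t h ht hh hth
    obtain ⟨hu0, huw, hu4⟩ := hroot t ht (by linarith)
    obtain ⟨hv0, hvw, hv4⟩ := hroot h hh (by linarith)
    have hneg : t ^ (-(1 / 4) : ℝ) = (t ^ (1 / 4 : ℝ))⁻¹ := Real.rpow_neg ht.le _
    have hlog := abs_log_le_rpow (T := T) ht (by linarith)
    have hdl := log_one_add_le_rpow (div_nonneg hh.le ht.le)
    rw [Real.div_rpow hh.le ht.le] at hdl ⊢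
    rw [hneg] at hlog
    set u := t ^ (1 / 4 : ℝ)
    set v := h ^ (1 / 4 : ℝ)
    have hmem : t ∈ Icc 0 T := ⟨ht.le, by linarith⟩
    have hmem' : t + h ∈ Icc 0 T := ⟨by linarith, hth⟩
    have h1 := hMa _ hmem'
    rw [Real.norm_eq_abs] at h1
    have h2 := hLa.dist_le_mul _ hmem' _ hmem
    have h3 := hLb.dist_le_mul _ hmem' _ hmem
    rw [Real.dist_eq, Real.dist_eq, add_sub_cancel_left, abs_of_pos hh] at h2 h3
    have h4 : |Real.log (t + h) - Real.log t| ≤ 4 * (v / u) := by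
      rw [← Real.log_div (by linarith) ht.ne', show (t + h) / t = 1 + h / t by field_simp,
        abs_of_nonneg (Real.log_nonneg (by have := div_nonneg hh.le ht.le; linarith))]
      exact hdl
    have hhv : h ≤ w ^ 3 * v := by
      rw [← hv4, show v ^ 4 = v ^ 3 * v by ring]
      gcongr
    have hvu : v ≤ w * (v / u) := by
      rw [mul_div_assoc', le_div_iff₀ hu0, mul_comm]
      gcongr
    have e1 : u⁻¹ * h ≤ w ^ 3 * (v / u) := by
      calc u⁻¹ * h ≤ u⁻¹ * (w ^ 3 * v) := by gcongr
        _ = _ := by ring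
    have e2 : h ≤ w ^ 4 * (v / u) := by
      calc h ≤ w ^ 3 * v := hhv
        _ ≤ w ^ 3 * (w * (v / u)) := by gcongr
        _ = _ := by ring
    have hsplit : f (t + h) - f t = (Real.log (t + h) - Real.log t) * a (t + h)
        + Real.log t * (a (t + h) - a t) + (b (t + h) - b t) := by
      rw [hfe t ht, hfe (t + h) (by linarith)]; ring
    calc |f (t + h) - f t| ≤ |Real.log (t + h) - Real.log t| * |a (t + h)|
          + |Real.log t| * |a (t + h) - a t| + |b (t + h) - b t| := by
          rw [hsplit, ← abs_mul, ← abs_mul]; exact abs_add_three _ _ _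
      _ ≤ 4 * (v / u) * Ma + (B * u⁻¹) * (La * h) + Lb * h := by gcongr
      _ = 4 * (v / u) * Ma + B * La * (u⁻¹ * h) + Lb * h := by ring
      _ ≤ 4 * (v / u) * Ma + B * La * (w ^ 3 * (v / u)) + Lb * (w ^ 4 * (v / u)) := by gcongr
      _ ≤ _ := by
          have : 0 ≤ (B * Ma + w * Mb) * (v / u) := by positivity
          linarith

/-! The domain enclosed by a polar curve -/

theorem polarPoint_eq_add (r θ : ℝ) : polarPoint r θ =
    (r * Real.cos θ) • EuclideanSpace.single (0 : Fin 2) (1 : ℝ)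
      + (r * Real.sin θ) • EuclideanSpace.single (1 : Fin 2) (1 : ℝ) := by
  ext i
  fin_cases i <;> simp [polarPoint]

theorem polarPoint_apply_zero (r θ : ℝ) : polarPoint r θ 0 = r * Real.cos θ := rfl

theorem polarPoint_apply_one (r θ : ℝ) : polarPoint r θ 1 = r * Real.sin θ := rfl

theorem norm_polarPoint {r : ℝ} (hr : 0 ≤ r) (θ : ℝ) : ‖polarPoint r θ‖ = r := by
  rw [EuclideanSpace.norm_eq, Fin.sum_univ_two, polarPoint_apply_zero, polarPoint_apply_one,
    Real.norm_eq_abs, Real.norm_eq_abs, sq_abs, sq_abs]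
  rw [show (r * Real.cos θ) ^ 2 + (r * Real.sin θ) ^ 2
    = r ^ 2 * (Real.sin θ ^ 2 + Real.cos θ ^ 2) by ring, Real.sin_sq_add_cos_sq, mul_one,
    Real.sqrt_sq hr]

theorem continuous_polarPoint : Continuous fun p : ℝ × ℝ => polarPoint p.1 p.2 := by
  simp only [polarPoint_eq_add]
  fun_prop

theorem exists_polarPoint_eq (x : EuclideanSpace ℝ (Fin 2)) :
    ∃ θ ∈ Icc (-Real.pi) Real.pi, x = polarPoint ‖x‖ θ := by
  set z : ℂ := ⟨x 0, x 1⟩ with hz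
  have hnorm : ‖z‖ = ‖x‖ := by
    rw [EuclideanSpace.norm_eq, Fin.sum_univ_two, Complex.norm_eq_sqrt_sq_add_sq]
    simp [hz]
  refine ⟨z.arg, ⟨(Complex.neg_pi_lt_arg z).le, Complex.arg_le_pi z⟩, ?_⟩
  rw [← hnorm]
  ext i
  fin_cases i
  · exact (Complex.norm_mul_cos_arg z).symm
  · exact (Complex.norm_mul_sin_arg z).symm

theorem apply_eq_of_cos_sin_eq {R : ℝ → ℝ} (hR : Function.Periodic R (2 * Real.pi)) {θ ψ : ℝ}
    (hc : Real.cos θ = Real.cos ψ) (hs : Real.sin θ = Real.sin ψ) : R θ = R ψ := by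
  obtain ⟨k, hk⟩ := Real.Angle.angle_eq_iff_two_pi_dvd_sub.1 (Real.Angle.cos_sin_inj hc hs)
  have := hR.int_mul k ψ
  rw [← this]
  congr 1
  linarith

theorem apply_eq_of_polarPoint_eq {R : ℝ → ℝ} (hR : Function.Periodic R (2 * Real.pi))
    {r θ ψ : ℝ} (hr : r ≠ 0) (h : polarPoint r θ = polarPoint r ψ) : R θ = R ψ := by
  have h0 := congrArg (fun y : EuclideanSpace ℝ (Fin 2) => y 0) h
  have h1 := congrArg (fun y : EuclideanSpace ℝ (Fin 2) => y 1) h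
  simp only [polarPoint_apply_zero, polarPoint_apply_one] at h0 h1
  exact apply_eq_of_cos_sin_eq hR (mul_left_cancel₀ hr h0) (mul_left_cancel₀ hr h1)

theorem notMem_domain_iff {R : ℝ → ℝ} (hper : Function.Periodic R (2 * Real.pi))
    (hpos : ∀ θ, 0 < R θ) {x : EuclideanSpace ℝ (Fin 2)} :
    x ∉ domain R ↔ ∃ θ ∈ Icc (-Real.pi) Real.pi, R θ ≤ ‖x‖ ∧ x = polarPoint ‖x‖ θ := by
  constructor
  · intro h
    obtain ⟨θ, hθ, hx⟩ := exists_polarPoint_eq x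
    refine ⟨θ, hθ, ?_, hx⟩
    by_contra! hlt
    exact h ⟨‖x‖, θ, norm_nonneg x, hlt, hx⟩
  · rintro ⟨θ, -, hle, hx⟩ ⟨r, ψ, hr, hlt, hx'⟩
    have hn : ‖x‖ = r := by rw [hx', norm_polarPoint hr]
    rw [hn] at hx hle
    have := apply_eq_of_polarPoint_eq hper (show r ≠ 0 by linarith [hpos θ]) (hx'.symm.trans hx)
    linarith

theorem isOpen_domain {R : ℝ → ℝ} (hcont : Continuous R)
    (hper : Function.Periodic R (2 * Real.pi)) (hpos : ∀ θ, 0 < R θ) : IsOpen (domain R) := by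
  rw [← isClosed_compl_iff, ← isSeqClosed_iff_isClosed]
  intro x y hx hy
  choose θ hθ hle hxe using fun n => (notMem_domain_iff hper hpos).1 (hx n)
  obtain ⟨ψ, hψ, k, hk, hlim⟩ := isCompact_Icc.tendsto_subseq hθ
  have hy' : Tendsto (x ∘ k) atTop (𝓝 y) := hy.comp hk.tendsto_atTop
  refine (notMem_domain_iff hper hpos).2 ⟨ψ, hψ, ?_, ?_⟩
  · exact le_of_tendsto_of_tendsto' ((hcont.tendsto ψ).comp hlim) hy'.norm fun n => hle (k n)
  · refine tendsto_nhds_unique hy' ?_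
    have := (continuous_polarPoint.tendsto (‖y‖, ψ)).comp (hy'.norm.prodMk_nhds hlim)
    exact this.congr fun n => (hxe (k n)).symm

theorem polarPoint_mem_domain {R : ℝ → ℝ} (hpos : ∀ θ, 0 < R θ) {s : ℝ} (hs0 : 0 ≤ s)
    (hs1 : s < 1) (θ : ℝ) : polarPoint (s * R θ) θ ∈ domain R :=
  ⟨s * R θ, θ, mul_nonneg hs0 (hpos θ).le, by nlinarith [hpos θ], rfl⟩

theorem polarPoint_mem_closure_domain {R : ℝ → ℝ} (hpos : ∀ θ, 0 < R θ) {s : ℝ} (hs0 : 0 ≤ s)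
    (hs1 : s ≤ 1) (θ : ℝ) : polarPoint (s * R θ) θ ∈ closure (domain R) := by
  have hlim : Tendsto (fun n : ℕ => polarPoint ((1 - 1 / ((n : ℝ) + 1)) * (s * R θ)) θ) atTop
      (𝓝 (polarPoint (s * R θ) θ)) := by
    have h1 : Tendsto (fun n : ℕ => (1 - 1 / ((n : ℝ) + 1)) * (s * R θ)) atTop
        (𝓝 ((1 - 0) * (s * R θ))) :=
      (tendsto_const_nhds.sub tendsto_one_div_add_atTop_nhds_zero_nat).mul_const _
    rw [sub_zero, one_mul] at h1
    exact (continuous_polarPoint.tendsto (s * R θ, θ)).comp (h1.prodMk_nhds tendsto_const_nhds)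
  refine mem_closure_of_tendsto hlim (Eventually.of_forall fun n => ?_)
  have h0 : 0 < 1 / ((n : ℝ) + 1) := by positivity
  have h1 : 1 / ((n : ℝ) + 1) ≤ 1 := by
    rw [div_le_one (by positivity)]; linarith [Nat.cast_nonneg (α := ℝ) n]
  rw [← mul_assoc]
  exact polarPoint_mem_domain hpos (by nlinarith) (by nlinarith) θ

/-! Green's second identity on a star-shaped domain -/

/-- The integrand of Green's second identity for a function with value `u` and gradient `(p, q)` and
the radial function `h(|y|² / 4)` at `y = (a, b)`, against the normal vector `(n, m)`; here `h'` is
the derivative of `h`. -/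
def flux (h h' : ℝ → ℝ) (a b u p q n m : ℝ) : ℝ :=
  h ((a ^ 2 + b ^ 2) / 4) * (p * n + q * m)
    - u * h' ((a ^ 2 + b ^ 2) / 4) * ((a * n + b * m) / 2)

/-- The partial derivative in the `i`-th coordinate. -/
def partialD (u : EuclideanSpace ℝ (Fin 2) → ℝ) (i : Fin 2) (y : EuclideanSpace ℝ (Fin 2)) : ℝ :=
  fderiv ℝ u y (EuclideanSpace.single i 1)

theorem hasDerivAt_comp_curve {u : EuclideanSpace ℝ (Fin 2) → ℝ} {c : ℝ → EuclideanSpace ℝ (Fin 2)}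
    {t c₀ c₁ : ℝ} (hu : DifferentiableAt ℝ u (c t))
    (hc : HasDerivAt c (c₀ • EuclideanSpace.single (0 : Fin 2) (1 : ℝ)
      + c₁ • EuclideanSpace.single (1 : Fin 2) (1 : ℝ)) t) :
    HasDerivAt (fun s => u (c s)) (c₀ * partialD u 0 (c t) + c₁ * partialD u 1 (c t)) t := by
  refine (hu.hasFDerivAt.comp_hasDerivAt t hc).congr_deriv ?_
  simp [partialD]

theorem differentiableAt_partialD {u : EuclideanSpace ℝ (Fin 2) → ℝ}
    {y : EuclideanSpace ℝ (Fin 2)} (hu : ContDiffAt ℝ 2 u y) (i : Fin 2) :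
    DifferentiableAt ℝ (partialD u i) y := by
  have h1 : ContDiffAt ℝ 1 (fderiv ℝ u) y := hu.fderiv_right (by norm_num)
  exact (h1.differentiableAt one_ne_zero).clm_apply (differentiableAt_const _)

theorem partialD_partialD {u : EuclideanSpace ℝ (Fin 2) → ℝ}
    {y : EuclideanSpace ℝ (Fin 2)} (hu : ContDiffAt ℝ 2 u y) (i j : Fin 2) :
    partialD (partialD u i) j y = fderiv ℝ (fderiv ℝ u) y (EuclideanSpace.single j 1)
      (EuclideanSpace.single i 1) := by
  have h1 : ContDiffAt ℝ 1 (fderiv ℝ u) y := hu.fderiv_right (by norm_num)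
  have h2 := (h1.differentiableAt one_ne_zero).hasFDerivAt.clm_apply
    (hasFDerivAt_const (EuclideanSpace.single i (1 : ℝ)) y)
  rw [partialD, show partialD u i = fun y => fderiv ℝ u y (EuclideanSpace.single i 1) from rfl,
    h2.fderiv]
  simp

theorem partialD_comm {u : EuclideanSpace ℝ (Fin 2) → ℝ}
    {y : EuclideanSpace ℝ (Fin 2)} (hu : ContDiffAt ℝ 2 u y) :
    partialD (partialD u 0) 1 y = partialD (partialD u 1) 0 y := by
  rw [partialD_partialD hu, partialD_partialD hu]
  exact (hu.isSymmSndFDerivAt (by simp)) _ _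

theorem laplacian_eq_partialD {u : EuclideanSpace ℝ (Fin 2) → ℝ}
    {y : EuclideanSpace ℝ (Fin 2)} (hu : ContDiffAt ℝ 2 u y) :
    Laplacian.laplacian u y = partialD (partialD u 0) 0 y + partialD (partialD u 1) 1 y := by
  rw [InnerProductSpace.laplacian_eq_iteratedFDeriv_orthonormalBasis u
    (EuclideanSpace.basisFun (Fin 2) ℝ)]
  simp [partialD_partialD hu, iteratedFDeriv_two_apply]

theorem hasDerivAt_flux {h h' h'' : ℝ → ℝ} (hh : ∀ t > 0, HasDerivAt h (h' t) t)
    (hh' : ∀ t > 0, HasDerivAt h' (h'' t) t) {u : EuclideanSpace ℝ (Fin 2) → ℝ}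
    {c : ℝ → EuclideanSpace ℝ (Fin 2)} {a b n m : ℝ → ℝ} {t c₀ c₁ n' m' : ℝ}
    (hu : ContDiffAt ℝ 2 u (c t)) (hc : HasDerivAt c (c₀ • EuclideanSpace.single (0 : Fin 2) (1 : ℝ)
      + c₁ • EuclideanSpace.single (1 : Fin 2) (1 : ℝ)) t)
    (ha : HasDerivAt a c₀ t) (hb : HasDerivAt b c₁ t) (hn : HasDerivAt n n' t)
    (hm : HasDerivAt m m' t) (hpos : 0 < a t ^ 2 + b t ^ 2) :
    HasDerivAt (fun s => flux h h' (a s) (b s) (u (c s)) (partialD u 0 (c s)) (partialD u 1 (c s))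
      (n s) (m s))
      (h' ((a t ^ 2 + b t ^ 2) / 4) * ((a t * c₀ + b t * c₁) / 2)
          * (partialD u 0 (c t) * n t + partialD u 1 (c t) * m t)
        + h ((a t ^ 2 + b t ^ 2) / 4) *
          ((c₀ * partialD (partialD u 0) 0 (c t) + c₁ * partialD (partialD u 0) 1 (c t)) * n t
            + partialD u 0 (c t) * n'
            + (c₀ * partialD (partialD u 1) 0 (c t) + c₁ * partialD (partialD u 1) 1 (c t)) * m t
            + partialD u 1 (c t) * m')
        - ((c₀ * partialD u 0 (c t) + c₁ * partialD u 1 (c t)) * h' ((a t ^ 2 + b t ^ 2) / 4)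
              * ((a t * n t + b t * m t) / 2)
            + u (c t) * (h'' ((a t ^ 2 + b t ^ 2) / 4) * ((a t * c₀ + b t * c₁) / 2))
              * ((a t * n t + b t * m t) / 2)
            + u (c t) * h' ((a t ^ 2 + b t ^ 2) / 4)
              * ((c₀ * n t + a t * n' + c₁ * m t + b t * m') / 2))) t := by
  have hτ : HasDerivAt (fun s => (a s ^ 2 + b s ^ 2) / 4) ((a t * c₀ + b t * c₁) / 2) t := by
    refine (((ha.pow 2).add (hb.pow 2)).div_const 4).congr_deriv ?_
    norm_num; ring
  have hpos' : 0 < (a t ^ 2 + b t ^ 2) / 4 := by positivity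
  have d1 := (hh _ hpos').comp t hτ
  have d2 := (hh' _ hpos').comp t hτ
  have d3 := hasDerivAt_comp_curve (hu.differentiableAt two_ne_zero) hc
  have d4 := hasDerivAt_comp_curve (differentiableAt_partialD hu 0) hc
  have d5 := hasDerivAt_comp_curve (differentiableAt_partialD hu 1) hc
  refine ((d1.mul ((d4.mul hn).add (d5.mul hm))).sub ((d3.mul d2).mul
    (((ha.mul hn).add (hb.mul hm)).div_const 2))).congr_deriv ?_
  simp only [Function.comp_apply, Pi.mul_apply, Pi.add_apply]
  ring

theorem differentiableAt_flux {h h' h'' : ℝ → ℝ} (hh : ∀ t > 0, HasDerivAt h (h' t) t)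
    (hh' : ∀ t > 0, HasDerivAt h' (h'' t) t) {u : EuclideanSpace ℝ (Fin 2) → ℝ}
    {c : ℝ × ℝ → EuclideanSpace ℝ (Fin 2)} {a b n m : ℝ × ℝ → ℝ} {t : ℝ × ℝ}
    (hu : ContDiffAt ℝ 2 u (c t)) (hc : DifferentiableAt ℝ c t)
    (ha : DifferentiableAt ℝ a t) (hb : DifferentiableAt ℝ b t) (hn : DifferentiableAt ℝ n t)
    (hm : DifferentiableAt ℝ m t) (hpos : 0 < a t ^ 2 + b t ^ 2) :
    DifferentiableAt ℝ (fun s => flux h h' (a s) (b s) (u (c s)) (partialD u 0 (c s))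
      (partialD u 1 (c s)) (n s) (m s)) t := by
  have hpos' : 0 < (a t ^ 2 + b t ^ 2) / 4 := by positivity
  have hτ : DifferentiableAt ℝ (fun s => (a s ^ 2 + b s ^ 2) / 4) t := by fun_prop
  have d1 : DifferentiableAt ℝ (fun s => h ((a s ^ 2 + b s ^ 2) / 4)) t :=
    (hh _ hpos').differentiableAt.comp t hτ
  have d2 : DifferentiableAt ℝ (fun s => h' ((a s ^ 2 + b s ^ 2) / 4)) t :=
    (hh' _ hpos').differentiableAt.comp t hτ
  have d3 : DifferentiableAt ℝ (fun s => u (c s)) t :=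
    (hu.differentiableAt two_ne_zero).comp t hc
  have d4 : DifferentiableAt ℝ (fun s => partialD u 0 (c s)) t :=
    (differentiableAt_partialD hu 0).comp t hc
  have d5 : DifferentiableAt ℝ (fun s => partialD u 1 (c s)) t :=
    (differentiableAt_partialD hu 1).comp t hc
  have d6 : DifferentiableAt ℝ (fun s => (a s * n s + b s * m s) / 2) t := by fun_prop
  exact (d1.mul ((d4.mul hn).add (d5.mul hm))).sub ((d3.mul d2).mul d6)

/-- Components of the tangent vector of the polar curve `r = R(θ)`. -/
def tangentX (R : ℝ → ℝ) (θ : ℝ) : ℝ := deriv R θ * Real.cos θ - R θ * Real.sin θ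

/-- Components of the tangent vector of the polar curve `r = R(θ)`. -/
def tangentY (R : ℝ → ℝ) (θ : ℝ) : ℝ := deriv R θ * Real.sin θ + R θ * Real.cos θ

theorem integral_flux_dilated_eq_zero {R : ℝ → ℝ} (hR : ContDiff ℝ 2 R)
    (hper : Function.Periodic R (2 * Real.pi)) (hpos : ∀ θ, 0 < R θ)
    {h h' h'' : ℝ → ℝ} (hh : ∀ t > 0, HasDerivAt h (h' t) t)
    (hh' : ∀ t > 0, HasDerivAt h' (h'' t) t) {κ : ℝ}
    (hode : ∀ t > 0, t * h'' t + h' t = κ * h t)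
    {u : EuclideanSpace ℝ (Fin 2) → ℝ} (hu : ContDiffOn ℝ 2 u (domain R))
    (hpde : ∀ y ∈ domain R, Laplacian.laplacian u y = κ * u y) {x₀ x₁ : ℝ}
    (hx : ∀ s ∈ Icc (0 : ℝ) 1, ∀ θ, 0 < (s * R θ * Real.cos θ - x₀) ^ 2
      + (s * R θ * Real.sin θ - x₁) ^ 2) {s : ℝ} (hs0 : 0 ≤ s) (hs1 : s < 1) :
    ∫ θ in (0 : ℝ)..(2 * Real.pi), flux h h' (s * R θ * Real.cos θ - x₀)
      (s * R θ * Real.sin θ - x₁) (u (polarPoint (s * R θ) θ))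
      (partialD u 0 (polarPoint (s * R θ) θ)) (partialD u 1 (polarPoint (s * R θ) θ))
      (s * tangentY R θ) (-(s * tangentX R θ)) = 0 := by
  have hopen := isOpen_domain hR.continuous hper hpos
  have hRd : Differentiable ℝ R := hR.differentiable two_ne_zero
  have hRd' : Differentiable ℝ (deriv R) := by
    have : ContDiff ℝ (1 + 1) R := by simpa [one_add_one_eq_two] using hR
    exact (contDiff_succ_iff_deriv.1 this).2.2.differentiable one_ne_zero
  have hcu : ∀ p : ℝ × ℝ, p.1 ∈ Icc 0 s → ContDiffAt ℝ 2 u (polarPoint (p.1 * R p.2) p.2) :=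
    fun p hp => hu.contDiffAt (hopen.mem_nhds
      (polarPoint_mem_domain hpos hp.1 (hp.2.trans_lt hs1) p.2))
  let F : ℝ × ℝ → ℝ := fun p => flux h h' (p.1 * R p.2 * Real.cos p.2 - x₀)
      (p.1 * R p.2 * Real.sin p.2 - x₁) (u (polarPoint (p.1 * R p.2) p.2))
      (partialD u 0 (polarPoint (p.1 * R p.2) p.2)) (partialD u 1 (polarPoint (p.1 * R p.2) p.2))
      (p.1 * tangentY R p.2) (-(p.1 * tangentX R p.2))
  let G : ℝ × ℝ → ℝ := fun p => -flux h h' (p.1 * R p.2 * Real.cos p.2 - x₀)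
      (p.1 * R p.2 * Real.sin p.2 - x₁) (u (polarPoint (p.1 * R p.2) p.2))
      (partialD u 0 (polarPoint (p.1 * R p.2) p.2)) (partialD u 1 (polarPoint (p.1 * R p.2) p.2))
      (R p.2 * Real.sin p.2) (-(R p.2 * Real.cos p.2))
  have hcd : Differentiable ℝ fun p : ℝ × ℝ => polarPoint (p.1 * R p.2) p.2 := by
    simp only [polarPoint_eq_add]
    fun_prop
  have hFd : ∀ p : ℝ × ℝ, p.1 ∈ Icc 0 s → DifferentiableAt ℝ F p := fun p hp =>
    differentiableAt_flux hh hh' (hcu p hp) (hcd p) (by fun_prop) (by fun_prop)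
      (by unfold tangentY; fun_prop) (by unfold tangentX; fun_prop)
      (hx p.1 ⟨hp.1, hp.2.trans hs1.le⟩ p.2)
  have hGd : ∀ p : ℝ × ℝ, p.1 ∈ Icc 0 s → DifferentiableAt ℝ G p := fun p hp =>
    (differentiableAt_flux hh hh' (hcu p hp) (hcd p) (by fun_prop) (by fun_prop)
      (by fun_prop) (by fun_prop)
      (hx p.1 ⟨hp.1, hp.2.trans hs1.le⟩ p.2)).neg
  have hdiv : ∀ p : ℝ × ℝ, p.1 ∈ Icc 0 s → fderiv ℝ F p (1, 0) + fderiv ℝ G p (0, 1) = 0 := by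
    rintro ⟨r, θ⟩ hp
    have hu' := hcu _ hp
    have hmem : polarPoint (r * R θ) θ ∈ domain R :=
      polarPoint_mem_domain hpos hp.1 (hp.2.trans_lt hs1) θ
    have hxp := hx r ⟨hp.1, hp.2.trans hs1.le⟩ θ
    have hcR := (hRd θ).hasDerivAt
    have hcos := Real.hasDerivAt_cos θ
    have hsin := Real.hasDerivAt_sin θ
    have hcx : HasDerivAt (fun θ => R θ * Real.cos θ) (tangentX R θ) θ :=
      (hcR.mul hcos).congr_deriv (by rw [tangentX]; ring)
    have hcy : HasDerivAt (fun θ => R θ * Real.sin θ) (tangentY R θ) θ :=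
      (hcR.mul hsin).congr_deriv (by rw [tangentY])
    have e1 : HasDerivAt (fun q : ℝ => (q, θ)) (1, 0) r :=
      (hasDerivAt_id r).prodMk (hasDerivAt_const r θ)
    have e2 : HasDerivAt (fun q : ℝ => (r, q)) (0, 1) θ :=
      (hasDerivAt_const θ r).prodMk (hasDerivAt_id θ)
    have f1 : HasDerivAt (F ∘ fun q : ℝ => (q, θ)) (fderiv ℝ F (r, θ) (1, 0)) r :=
      HasFDerivAt.comp_hasDerivAt r (hFd (r, θ) hp).hasFDerivAt e1
    have g1 : HasDerivAt (G ∘ fun q : ℝ => (r, q)) (fderiv ℝ G (r, θ) (0, 1)) θ :=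
      HasFDerivAt.comp_hasDerivAt θ (hGd (r, θ) hp).hasFDerivAt e2
    have lin : ∀ k : ℝ, HasDerivAt (fun q : ℝ => q * k) k r := fun k => by
      simpa using (hasDerivAt_id r).mul_const k
    have lin2 : ∀ k k' : ℝ, HasDerivAt (fun q : ℝ => q * k * k') (k * k') r := fun k k' => by
      simpa using ((hasDerivAt_id r).mul_const k).mul_const k'
    have f2 := hasDerivAt_flux hh hh' (c := fun q => polarPoint (q * R θ) θ)
      (a := fun q => q * R θ * Real.cos θ - x₀) (b := fun q => q * R θ * Real.sin θ - x₁)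
      (n := fun q => q * tangentY R θ) (m := fun q => -(q * tangentX R θ)) (t := r)
      (c₀ := R θ * Real.cos θ) (c₁ := R θ * Real.sin θ) hu'
      (by
        simp only [polarPoint_eq_add]
        exact ((lin2 _ _).smul_const _).add ((lin2 _ _).smul_const _))
      ((lin2 _ _).sub_const x₀) ((lin2 _ _).sub_const x₁) (lin _) (lin _).neg hxp
    have hcx' : HasDerivAt (fun θ => r * R θ * Real.cos θ) (r * tangentX R θ) θ := by
      simpa only [mul_assoc] using hcx.const_mul r
    have hcy' : HasDerivAt (fun θ => r * R θ * Real.sin θ) (r * tangentY R θ) θ := by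
      simpa only [mul_assoc] using hcy.const_mul r
    have g2 := (hasDerivAt_flux hh hh' (c := fun q => polarPoint (r * R q) q)
      (a := fun q => r * R q * Real.cos q - x₀) (b := fun q => r * R q * Real.sin q - x₁)
      (n := fun q => R q * Real.sin q) (m := fun q => -(R q * Real.cos q)) (t := θ)
      (c₀ := r * tangentX R θ) (c₁ := r * tangentY R θ) hu'
      (by
        simp only [polarPoint_eq_add]
        exact (hcx'.smul_const _).add (hcy'.smul_const _))
      (hcx'.sub_const x₀) (hcy'.sub_const x₁) hcy hcx.neg hxp).neg
    rw [f1.unique f2, g1.unique g2]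
    have hlap := hpde _ hmem
    rw [laplacian_eq_partialD hu'] at hlap
    have hsym := partialD_comm hu'
    have ho := hode _ (div_pos hxp four_pos)
    simp only [hsym]
    generalize partialD (partialD u 0) 0 (polarPoint (r * R θ) θ) = H00 at *
    generalize partialD (partialD u 1) 1 (polarPoint (r * R θ) θ) = H11 at *
    generalize partialD (partialD u 1) 0 (polarPoint (r * R θ) θ) = H01 at *
    generalize partialD u 0 (polarPoint (r * R θ) θ) = p at *
    generalize partialD u 1 (polarPoint (r * R θ) θ) = q at *
    generalize u (polarPoint (r * R θ) θ) = v at *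
    generalize r * R θ * Real.cos θ - x₀ = A at *
    generalize r * R θ * Real.sin θ - x₁ = B at *
    generalize R θ * Real.cos θ = X at *
    generalize R θ * Real.sin θ = Y at *
    generalize tangentX R θ = X' at *
    generalize tangentY R θ = Y' at *
    linear_combination (h ((A ^ 2 + B ^ 2) / 4) * r * (X * Y' - Y * X')) * hlap
      - v * r * (X * Y' - Y * X') * ho
  have hpi : (0 : ℝ) ≤ 2 * Real.pi := by positivity
  have hrect : ∀ p : ℝ × ℝ, p ∈ uIcc 0 s ×ˢ uIcc 0 (2 * Real.pi) → p.1 ∈ Icc 0 s := by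
    intro p hp
    have := hp.1
    rwa [uIcc_of_le hs0] at this
  have hrect' : ∀ p : ℝ × ℝ, p ∈ Ioo (min 0 s) (max 0 s) ×ˢ
      Ioo (min 0 (2 * Real.pi)) (max 0 (2 * Real.pi)) \ (∅ : Set (ℝ × ℝ)) → p.1 ∈ Icc 0 s := by
    intro p hp
    have := hp.1.1
    rw [min_eq_left hs0, max_eq_right hs0] at this
    exact ⟨this.1.le, this.2.le⟩
  have hmain := integral2_divergence_prod_of_hasFDerivAt_off_countable F G (fderiv ℝ F) (fderiv ℝ G)
    0 0 s (2 * Real.pi) ∅ countable_empty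
    (fun p hp => (hFd p (hrect p hp)).continuousAt.continuousWithinAt)
    (fun p hp => (hGd p (hrect p hp)).continuousAt.continuousWithinAt)
    (fun p hp => (hFd p (hrect' p hp)).hasFDerivAt) (fun p hp => (hGd p (hrect' p hp)).hasFDerivAt)
    ((integrableOn_congr_fun (fun p hp => hdiv p (hrect p hp))
      (measurableSet_uIcc.prod measurableSet_uIcc)).2 integrableOn_zero)
  have hzero : ∫ x in (0 : ℝ)..s, ∫ y in (0 : ℝ)..(2 * Real.pi),
      fderiv ℝ F (x, y) (1, 0) + fderiv ℝ G (x, y) (0, 1) = 0 := by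
    rw [intervalIntegral.integral_congr (g := fun _ => 0), intervalIntegral.integral_zero]
    intro x hx'
    rw [uIcc_of_le hs0] at hx'
    simp only [hdiv (x, _) hx', intervalIntegral.integral_zero]
  have hGper : ∀ x, G (x, 2 * Real.pi) = G (x, 0) := by
    intro x
    have hR0 : R (2 * Real.pi) = R 0 := by simpa using hper 0
    simp [G, hR0, polarPoint]
  have hF0 : ∀ θ, F (0, θ) = 0 := by
    intro θ
    simp [F, flux]
  rw [hzero] at hmain
  simp only [hGper, hF0, intervalIntegral.integral_zero, sub_self, zero_add, sub_zero] at hmain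
  exact hmain.symm

theorem continuous_flux {X : Type*} [TopologicalSpace X] {h h' h'' : ℝ → ℝ}
    (hh : ∀ t > 0, HasDerivAt h (h' t) t) (hh' : ∀ t > 0, HasDerivAt h' (h'' t) t)
    {a b u p q n m : X → ℝ} (ha : Continuous a) (hb : Continuous b) (hu : Continuous u)
    (hp : Continuous p) (hq : Continuous q) (hn : Continuous n) (hm : Continuous m)
    (hpos : ∀ x, 0 < a x ^ 2 + b x ^ 2) :
    Continuous fun x => flux h h' (a x) (b x) (u x) (p x) (q x) (n x) (m x) := by
  have hτ : Continuous fun x => (a x ^ 2 + b x ^ 2) / 4 := by fun_prop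
  have hτ0 : ∀ x, (a x ^ 2 + b x ^ 2) / 4 ∈ Ioi (0 : ℝ) := fun x => div_pos (hpos x) four_pos
  have ho : ContinuousOn h (Ioi 0) := fun t ht => (hh t ht).continuousAt.continuousWithinAt
  have ho' : ContinuousOn h' (Ioi 0) := fun t ht => (hh' t ht).continuousAt.continuousWithinAt
  have c4 := ho.comp_continuous hτ hτ0
  have c5 := ho'.comp_continuous hτ hτ0
  exact (c4.mul ((hp.mul hn).add (hq.mul hm))).sub
    ((hu.mul c5).mul (((ha.mul hn).add (hb.mul hm)).div_const 2))

theorem integral_flux_boundary_eq_zero {R : ℝ → ℝ} (hR : ContDiff ℝ 2 R)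
    (hper : Function.Periodic R (2 * Real.pi)) (hpos : ∀ θ, 0 < R θ)
    {h h' h'' : ℝ → ℝ} (hh : ∀ t > 0, HasDerivAt h (h' t) t)
    (hh' : ∀ t > 0, HasDerivAt h' (h'' t) t) {κ : ℝ}
    (hode : ∀ t > 0, t * h'' t + h' t = κ * h t)
    {u : EuclideanSpace ℝ (Fin 2) → ℝ} (hu : ContDiffOn ℝ 2 u (domain R))
    (hpde : ∀ y ∈ domain R, Laplacian.laplacian u y = κ * u y)
    (huc : ContinuousOn u (closure (domain R))) {U V : EuclideanSpace ℝ (Fin 2) → ℝ}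
    (hU : ContinuousOn U (closure (domain R))) (hV : ContinuousOn V (closure (domain R)))
    (hUe : ∀ y ∈ domain R, U y = partialD u 0 y) (hVe : ∀ y ∈ domain R, V y = partialD u 1 y)
    {x₀ x₁ : ℝ} (hx : ∀ s ∈ Icc (0 : ℝ) 1, ∀ θ, 0 < (s * R θ * Real.cos θ - x₀) ^ 2
      + (s * R θ * Real.sin θ - x₁) ^ 2) :
    (Continuous fun θ => flux h h' (R θ * Real.cos θ - x₀)
      (R θ * Real.sin θ - x₁) (u (polarPoint (R θ) θ))
      (U (polarPoint (R θ) θ)) (V (polarPoint (R θ) θ)) (tangentY R θ) (-tangentX R θ)) ∧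
    ∫ θ in (0 : ℝ)..(2 * Real.pi), flux h h' (R θ * Real.cos θ - x₀)
      (R θ * Real.sin θ - x₁) (u (polarPoint (R θ) θ))
      (U (polarPoint (R θ) θ)) (V (polarPoint (R θ) θ)) (tangentY R θ) (-tangentX R θ) = 0 := by
  have hRc := hR.continuous
  have hRc' : Continuous (deriv R) := hR.continuous_deriv one_le_two
  let cl : ℝ → ℝ := fun s => max 0 (min s 1)
  have hcl : Continuous cl := by fun_prop
  have hcl0 : ∀ s, 0 ≤ cl s := fun s => le_max_left _ _
  have hcl1 : ∀ s, cl s ≤ 1 := fun s => max_le zero_le_one (min_le_right _ _)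
  have hcle : ∀ s ∈ Icc (0 : ℝ) 1, cl s = s := fun s hs => by
    simp only [cl, min_eq_left hs.2, max_eq_right hs.1]
  have hmem : ∀ p : ℝ × ℝ, polarPoint (cl p.1 * R p.2) p.2 ∈ closure (domain R) := fun p =>
    polarPoint_mem_closure_domain hpos (hcl0 _) (hcl1 _) _
  have hpt : Continuous fun p : ℝ × ℝ => polarPoint (cl p.1 * R p.2) p.2 :=
    continuous_polarPoint.comp
      (((hcl.comp continuous_fst).mul (hRc.comp continuous_snd)).prodMk continuous_snd)
  let I : ℝ → ℝ → ℝ := fun s θ => flux h h' (cl s * R θ * Real.cos θ - x₀)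
      (cl s * R θ * Real.sin θ - x₁) (u (polarPoint (cl s * R θ) θ))
      (U (polarPoint (cl s * R θ) θ)) (V (polarPoint (cl s * R θ) θ))
      (cl s * tangentY R θ) (-(cl s * tangentX R θ))
  have hIc : Continuous (Function.uncurry I) := by
    have c6 : Continuous (tangentX R) := by unfold tangentX; fun_prop
    have c7 : Continuous (tangentY R) := by unfold tangentY; fun_prop
    exact continuous_flux hh hh' (by fun_prop) (by fun_prop) (huc.comp_continuous hpt hmem)
      (hU.comp_continuous hpt hmem) (hV.comp_continuous hpt hmem)
      ((hcl.comp continuous_fst).mul (c7.comp continuous_snd))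
      ((hcl.comp continuous_fst).mul (c6.comp continuous_snd)).neg
      fun p => hx _ ⟨hcl0 _, hcl1 _⟩ _
  have hI1 : I 1 = fun θ => flux h h' (R θ * Real.cos θ - x₀)
      (R θ * Real.sin θ - x₁) (u (polarPoint (R θ) θ))
      (U (polarPoint (R θ) θ)) (V (polarPoint (R θ) θ)) (tangentY R θ) (-tangentX R θ) := by
    ext θ
    simp only [I, hcle 1 ⟨zero_le_one, le_rfl⟩, one_mul]
  have hint := intervalIntegral.continuous_parametric_intervalIntegral_of_continuous'
    (μ := volume) hIc 0 (2 * Real.pi)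
  have hzero : ∀ s ∈ Ico (0 : ℝ) 1, ∫ θ in (0 : ℝ)..(2 * Real.pi), I s θ = 0 := by
    intro s hs
    refine (intervalIntegral.integral_congr fun θ _ => ?_).trans
      (integral_flux_dilated_eq_zero hR hper hpos hh hh' hode hu hpde hx hs.1 hs.2)
    have hm := polarPoint_mem_domain hpos hs.1 hs.2 θ
    simp only [I, hcle s ⟨hs.1, hs.2.le⟩, hUe _ hm, hVe _ hm]
  have h1 : ∫ θ in (0 : ℝ)..(2 * Real.pi), I 1 θ = 0 := by
    have hev : (fun s => ∫ θ in (0 : ℝ)..(2 * Real.pi), I s θ) =ᶠ[𝓝[<] 1] fun _ => 0 := by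
      filter_upwards [Ico_mem_nhdsLT (zero_lt_one (α := ℝ))] with s hs using hzero s hs
    exact tendsto_nhds_unique ((hint.tendsto 1).mono_left nhdsWithin_le_nhds)
      (tendsto_const_nhds.congr' hev.symm)
  rw [hI1] at h1
  have hI1c : Continuous (I 1) := hIc.uncurry_left 1
  rw [hI1] at hI1c
  exact ⟨hI1c, h1⟩

/-! The boundary integral identity with an exterior pole -/

/-- Squared distance between the curve point with parameter `θ` and the `lam`-dilate of the curve
point with parameter `φ`. -/
def sqDist (R : ℝ → ℝ) (lam φ θ : ℝ) : ℝ :=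
  (lam * R φ) ^ 2 + R θ ^ 2 - 2 * (lam * R φ) * R θ * Real.cos (φ - θ)

/-- Double layer weight at the curve point with parameter `θ`, for a pole at the `lam`-dilate of the
curve point with parameter `φ`. -/
def layerWeight (R : ℝ → ℝ) (lam φ θ : ℝ) : ℝ :=
  R θ ^ 2 + lam * R φ * deriv R θ * Real.sin (φ - θ) - lam * R φ * R θ * Real.cos (φ - θ)

/-- The integrand of the boundary integral operator, in terms of a quarter of the squared distance
`t` and the double layer weight `w`. -/
def layerIntegrand (μ β : ℝ) (R : ℝ → ℝ) (φ θ t w : ℝ) : ℝ :=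
  β * greenT t * Real.sqrt (deriv R θ ^ 2 + R θ ^ 2)
    - ((μ + curvature R θ) * kernelT t - (curvature R θ - curvature R φ) / (8 * Real.pi * t)) * w

theorem add_sq_eq_sqDist (R : ℝ → ℝ) (lam φ θ : ℝ) :
    (R θ * Real.cos θ - lam * R φ * Real.cos φ) ^ 2
      + (R θ * Real.sin θ - lam * R φ * Real.sin φ) ^ 2 = sqDist R lam φ θ := by
  rw [sqDist, Real.cos_sub]
  linear_combination R θ ^ 2 * Real.sin_sq_add_cos_sq θ
    + (lam * R φ) ^ 2 * Real.sin_sq_add_cos_sq φ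

theorem inner_eq_layerWeight (R : ℝ → ℝ) (lam φ θ : ℝ) :
    (R θ * Real.cos θ - lam * R φ * Real.cos φ) * tangentY R θ
      + (R θ * Real.sin θ - lam * R φ * Real.sin φ) * -tangentX R θ = layerWeight R lam φ θ := by
  rw [layerWeight, Real.cos_sub, Real.sin_sub, tangentX, tangentY]
  linear_combination R θ ^ 2 * Real.sin_sq_add_cos_sq θ

theorem exterior_pole_dist_pos {R : ℝ → ℝ} (hper : Function.Periodic R (2 * Real.pi))
    (hpos : ∀ θ, 0 < R θ) {lam : ℝ} (hlam : 1 < lam) (φ : ℝ) {s : ℝ} (hs : s ∈ Icc (0 : ℝ) 1)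
    (θ : ℝ) : 0 < (s * R θ * Real.cos θ - lam * R φ * Real.cos φ) ^ 2
      + (s * R θ * Real.sin θ - lam * R φ * Real.sin φ) ^ 2 := by
  by_contra! hle
  have h1 : s * R θ * Real.cos θ - lam * R φ * Real.cos φ = 0 := by nlinarith
  have h2 : s * R θ * Real.sin θ - lam * R φ * Real.sin φ = 0 := by nlinarith
  have hlR : 0 < lam * R φ := mul_pos (by linarith) (hpos φ)
  have hsR : 0 ≤ s * R θ := mul_nonneg hs.1 (hpos θ).le
  have hsq : (s * R θ) ^ 2 = (lam * R φ) ^ 2 := by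
    linear_combination (s * R θ * Real.cos θ + lam * R φ * Real.cos φ) * h1
      + (s * R θ * Real.sin θ + lam * R φ * Real.sin φ) * h2
      - (s * R θ) ^ 2 * Real.sin_sq_add_cos_sq θ + (lam * R φ) ^ 2 * Real.sin_sq_add_cos_sq φ
  have heq : s * R θ = lam * R φ := by
    rwa [sq_eq_sq₀ hsR hlR.le] at hsq
  rw [heq] at h1 h2
  have hRe : R θ = R φ := apply_eq_of_cos_sin_eq hper
    (mul_left_cancel₀ hlR.ne' (sub_eq_zero.1 h1)) (mul_left_cancel₀ hlR.ne' (sub_eq_zero.1 h2))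
  rw [hRe] at heq
  have := mul_right_cancel₀ (hpos φ).ne' heq
  linarith [hs.2]

theorem gradient_apply (σ : EuclideanSpace ℝ (Fin 2) → ℝ) (y : EuclideanSpace ℝ (Fin 2))
    (i : Fin 2) : (∇ σ y) i = partialD σ i y := by
  have : inner ℝ (∇ σ y) (EuclideanSpace.single i (1 : ℝ)) = partialD σ i y := by
    rw [gradient, InnerProductSpace.toDual_symm_apply, partialD]
  rw [← this, EuclideanSpace.inner_single_right]
  simp

theorem integral_layerIntegrand_eq_zero {μ β : ℝ} {R : ℝ → ℝ} (hR : IsSolutionBoundary μ β R)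
    {lam : ℝ} (hlam : 1 < lam) (φ : ℝ) :
    (Continuous fun θ => layerIntegrand μ β R φ θ (sqDist R lam φ θ / 4) (layerWeight R lam φ θ)) ∧
    ∫ θ in (0 : ℝ)..(2 * Real.pi),
      layerIntegrand μ β R φ θ (sqDist R lam φ θ / 4) (layerWeight R lam φ θ) = 0 := by
  obtain ⟨σ, hσ⟩ := hR.exists_solution
  obtain ⟨V, hVc, hVe, hVn⟩ := hσ.neumann
  have hR2 : ContDiff ℝ 2 R := hR.contDiff.of_le (by norm_num)
  have hx := fun s hs θ => exterior_pole_dist_pos hR.periodic hR.pos hlam φ (s := s) hs θ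
  have hD : ∀ θ, 0 < sqDist R lam φ θ := fun θ => by
    rw [← add_sq_eq_sqDist]
    simpa using hx 1 ⟨zero_le_one, le_rfl⟩ θ
  obtain ⟨c1, i1⟩ := integral_flux_boundary_eq_zero hR2 hR.periodic hR.pos
    (h' := greenT') (fun t ht => hasDerivAt_greenT ht) (fun t ht => hasDerivAt_greenT' ht) (κ := 1)
    (fun t ht => by rw [greenT_ode ht, one_mul]) hσ.contDiffOn
    (fun y hy => by have := hσ.equation y hy; linarith) hσ.continuousOn
    (U := fun y => V y 0) (V := fun y => V y 1)
    ((EuclideanSpace.proj (0 : Fin 2)).continuous.comp_continuousOn hVc)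
    ((EuclideanSpace.proj (1 : Fin 2)).continuous.comp_continuousOn hVc)
    (fun y hy => by rw [hVe y hy, gradient_apply]) (fun y hy => by rw [hVe y hy, gradient_apply]) hx
  obtain ⟨c2, i2⟩ := integral_flux_boundary_eq_zero hR2 hR.periodic hR.pos
    (h := Real.log) (h' := fun t => t⁻¹) (h'' := fun t => -(t ^ 2)⁻¹)
    (fun t ht => Real.hasDerivAt_log ht.ne') (fun t ht => hasDerivAt_inv ht.ne') (κ := 0)
    (fun t ht => by field_simp; ring) (u := fun _ => 1) contDiffOn_const
    (fun y hy => by simp [InnerProductSpace.laplacian_const]) continuousOn_const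
    (U := fun _ => 0) (V := fun _ => 0) continuousOn_const continuousOn_const
    (fun y hy => by simp [partialD]) (fun y hy => by simp [partialD]) hx
  have key : ∀ θ, layerIntegrand μ β R φ θ (sqDist R lam φ θ / 4) (layerWeight R lam φ θ)
      = flux greenT greenT' (R θ * Real.cos θ - lam * R φ * Real.cos φ)
          (R θ * Real.sin θ - lam * R φ * Real.sin φ) (σ (polarPoint (R θ) θ))
          (V (polarPoint (R θ) θ) 0) (V (polarPoint (R θ) θ) 1) (tangentY R θ) (-tangentX R θ)
        + (μ + curvature R φ) / (4 * Real.pi) *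
          flux Real.log (fun t => t⁻¹) (R θ * Real.cos θ - lam * R φ * Real.cos φ)
          (R θ * Real.sin θ - lam * R φ * Real.sin φ) 1 0 0 (tangentY R θ) (-tangentX R θ) := by
    intro θ
    have hS : 0 < Real.sqrt (deriv R θ ^ 2 + R θ ^ 2) :=
      Real.sqrt_pos.2 (by have := hR.pos θ; positivity)
    have hn := hVn θ
    have hn' : V (polarPoint (R θ) θ) 0 * tangentY R θ + V (polarPoint (R θ) θ) 1 * -tangentX R θ
        = β * Real.sqrt (deriv R θ ^ 2 + R θ ^ 2) := by
      rw [normal, inner_smul_right, PiLp.inner_apply, Fin.sum_univ_two] at hn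
      simp only [RCLike.inner_apply, conj_trivial] at hn
      rw [← hn, tangentX, tangentY]
      field_simp
      simp
      ring
    rw [flux, flux, add_sq_eq_sqDist, inner_eq_layerWeight, hn', hσ.dirichlet, layerIntegrand,
      kernelT]
    have hD' := (hD θ).ne'
    have hpi := Real.pi_ne_zero
    field_simp
    ring
  simp only [key]
  have c3 := (continuous_const (y := (μ + curvature R φ) / (4 * Real.pi))).fun_mul c2
  refine ⟨c1.add c3, ?_⟩
  rw [intervalIntegral.integral_add (c1.intervalIntegrable _ _) (c3.intervalIntegrable _ _),
    intervalIntegral.integral_const_mul, i1, i2]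
  simp

/-! Estimates for the regularized operator -/

theorem exists_layerIntegrand_bound (β : ℝ) {T A : ℝ} (hT : 0 < T) (hA : 0 ≤ A) :
    ∃ C : ℝ, 0 ≤ C ∧ ∀ S k d w t : ℝ, |S| ≤ A → |k| ≤ A → |w| ≤ A → 0 < t → |d * w| ≤ A * t →
      (t ≤ T → |β * greenT t * S - (k * kernelT t - d / (8 * Real.pi * t)) * w|
        ≤ C * t ^ (-(1 / 4) : ℝ)) ∧
      ∀ h, 0 < h → t + h ≤ T →
        |(β * greenT (t + h) * S - (k * kernelT (t + h) - d / (8 * Real.pi * (t + h))) * w)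
          - (β * greenT t * S - (k * kernelT t - d / (8 * Real.pi * t)) * w)|
        ≤ C * (h / t) ^ (1 / 4 : ℝ) := by
  obtain ⟨Cg, hCg0, hCg, hCg'⟩ := logSingular_greenT.exists_bound hT
  obtain ⟨Cq, hCq0, hCq, hCq'⟩ := logSingular_kernelT.exists_bound hT
  have hpi := Real.pi_pos
  have h8 : (1 : ℝ) ≤ 8 * Real.pi := by linarith [Real.pi_gt_three]
  set w₀ := T ^ (1 / 4 : ℝ) with hw₀
  have hw₀' : 0 < w₀ := by positivity
  refine ⟨|β| * Cg * A + A * Cq * A + A * w₀ + A, by positivity, ?_⟩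
  intro S k d w t hS hk hw ht hdw
  refine ⟨fun htT => ?_, fun h hh hth => ?_⟩
  · have h1 := hCg t ht htT
    have h2 := hCq t ht htT
    set P := t ^ (-(1 / 4) : ℝ) with hP
    have hP0 : 0 < P := by positivity
    have hwP : 1 ≤ w₀ * P := by
      rw [hP, Real.rpow_neg ht.le, ← div_eq_mul_inv, one_le_div (by positivity), hw₀]
      gcongr
    have h3 : |d / (8 * Real.pi * t) * w| ≤ A * (w₀ * P) := by
      rw [div_mul_eq_mul_div, abs_div, abs_of_pos (by positivity : 0 < 8 * Real.pi * t),
        div_le_iff₀ (by positivity)]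
      calc |d * w| ≤ A * t := hdw
        _ ≤ A * (w₀ * P) * (8 * Real.pi * t) := by
          have e1 : 1 * 1 ≤ (w₀ * P) * (8 * Real.pi) := by gcongr
          have : 0 ≤ A * t := by positivity
          nlinarith
    calc |β * greenT t * S - (k * kernelT t - d / (8 * Real.pi * t)) * w|
        = |β * greenT t * S + -(k * kernelT t * w) + d / (8 * Real.pi * t) * w| := by ring_nf
      _ ≤ |β * greenT t * S| + |-(k * kernelT t * w)| + |d / (8 * Real.pi * t) * w| :=
          abs_add_three _ _ _
      _ ≤ |β| * (Cg * P) * A + A * (Cq * P) * A + A * (w₀ * P) := by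
          rw [abs_neg, abs_mul, abs_mul, abs_mul, abs_mul]
          gcongr
      _ ≤ _ := by nlinarith [mul_nonneg hA hP0.le]
  · have h1 := hCg' t h ht hh hth
    have h2 := hCq' t h ht hh hth
    set P := (h / t) ^ (1 / 4 : ℝ) with hP
    have hht : 0 < h / t := by positivity
    have hP0 : 0 < P := by positivity
    have hfrac : h / (t + h) ≤ P := by
      rcases le_or_gt (h / t) 1 with hle | hgt
      · calc h / (t + h) ≤ h / t := by gcongr; linarith
          _ = (h / t) ^ (1 : ℝ) := (Real.rpow_one _).symm
          _ ≤ P := Real.rpow_le_rpow_of_exponent_ge hht hle (by norm_num)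
      · calc h / (t + h) ≤ 1 := by rw [div_le_one (by positivity)]; linarith
          _ ≤ P := Real.one_le_rpow hgt.le (by norm_num)
    have h3 : |d / (8 * Real.pi * t) * w - d / (8 * Real.pi * (t + h)) * w| ≤ A * P := by
      have : d / (8 * Real.pi * t) * w - d / (8 * Real.pi * (t + h)) * w
          = d * w * (h / (t + h)) / (8 * Real.pi * t) := by
        have : t + h ≠ 0 := by positivity
        field_simp
        ring
      rw [this, abs_div, abs_mul, abs_of_pos (by positivity : 0 < 8 * Real.pi * t),
        abs_of_pos (by positivity : 0 < h / (t + h)), div_le_iff₀ (by positivity)]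
      calc |d * w| * (h / (t + h)) ≤ A * t * P := by gcongr
        _ ≤ A * P * (8 * Real.pi * t) := by
          have : 0 ≤ A * t * P := by positivity
          nlinarith
    calc |(β * greenT (t + h) * S - (k * kernelT (t + h) - d / (8 * Real.pi * (t + h))) * w)
          - (β * greenT t * S - (k * kernelT t - d / (8 * Real.pi * t)) * w)|
        = |β * (greenT (t + h) - greenT t) * S + -(k * (kernelT (t + h) - kernelT t) * w)
          + -(d / (8 * Real.pi * t) * w - d / (8 * Real.pi * (t + h)) * w)| := by ring_nf
      _ ≤ |β * (greenT (t + h) - greenT t) * S| + |-(k * (kernelT (t + h) - kernelT t) * w)|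
          + |-(d / (8 * Real.pi * t) * w - d / (8 * Real.pi * (t + h)) * w)| := abs_add_three _ _ _
      _ ≤ |β| * (Cg * P) * A + A * (Cq * P) * A + A * P := by
          rw [abs_neg, abs_neg, abs_mul, abs_mul, abs_mul, abs_mul]
          gcongr
      _ ≤ _ := by
          have : 0 ≤ A * w₀ * P := by positivity
          linarith

theorem contDiff_deriv_of_contDiff {n : ℕ} {R : ℝ → ℝ} (hR : ContDiff ℝ (n + 1 : ℕ) R) :
    ContDiff ℝ n (deriv R) := by
  have : ContDiff ℝ (n + 1) R := by exact_mod_cast hR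
  exact (contDiff_succ_iff_deriv.1 this).2.2

theorem contDiff_curvature {R : ℝ → ℝ} (hR : ContDiff ℝ 3 R) (hpos : ∀ θ, 0 < R θ) :
    ContDiff ℝ 1 (curvature R) := by
  have h1 : ContDiff ℝ 2 (deriv R) := contDiff_deriv_of_contDiff (n := 2) hR
  have h2 : ContDiff ℝ 1 (iteratedDeriv 2 R) := by
    rw [iteratedDeriv_succ, iteratedDeriv_one]
    exact_mod_cast contDiff_deriv_of_contDiff (n := 1) h1
  have h0 : ContDiff ℝ 1 R := hR.of_le (by norm_num)
  have h1' : ContDiff ℝ 1 (deriv R) := h1.of_le (by norm_num)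
  have hden : ∀ θ, 0 < R θ ^ 2 + deriv R θ ^ 2 := fun θ => by have := hpos θ; positivity
  refine ContDiff.div ?_ ?_ fun θ => (Real.rpow_pos_of_pos (hden θ) _).ne'
  · exact ((h0.pow 2).add (contDiff_const.mul (h1'.pow 2))).sub (h0.mul h2)
  · exact ((h0.pow 2).add (h1'.pow 2)).rpow_const_of_ne fun θ => (hden θ).ne'

theorem periodic_deriv {f : ℝ → ℝ} {T : ℝ} (hf : Function.Periodic f T) :
    Function.Periodic (deriv f) T := by
  intro x
  rw [← deriv_comp_add_const f T x]
  congr 1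
  exact funext hf

theorem periodic_curvature {R : ℝ → ℝ} {T : ℝ} (hR : Function.Periodic R T) :
    Function.Periodic (curvature R) T := by
  intro x
  have h2 : Function.Periodic (iteratedDeriv 2 R) T := by
    rw [iteratedDeriv_succ, iteratedDeriv_one]
    exact periodic_deriv (periodic_deriv hR)
  rw [curvature, curvature, hR x, periodic_deriv hR x, h2 x]

theorem sqDist_ge {R : ℝ → ℝ} {m : ℝ} (hm : 0 ≤ m) {lam φ θ : ℝ} (hlam : 1 ≤ lam)
    (hφ : m ≤ R φ) (hθ : m ≤ R θ) (hs : |θ - φ| ≤ Real.pi) :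
    m ^ 2 / Real.pi ^ 2 * (θ - φ) ^ 2 ≤ sqDist R lam φ θ / 4 := by
  have hcos := Real.cos_le_one_sub_mul_cos_sq hs
  have h1 : m ≤ lam * R φ := by nlinarith
  have hc : 0 ≤ 2 / Real.pi ^ 2 * (θ - φ) ^ 2 := by positivity
  have h2 : m * m * (2 / Real.pi ^ 2 * (θ - φ) ^ 2)
      ≤ lam * R φ * R θ * (1 - Real.cos (θ - φ)) :=
    mul_le_mul (mul_le_mul h1 hθ hm (hm.trans h1)) (by linarith) hc
      (mul_nonneg (hm.trans h1) (hm.trans hθ))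
  rw [sqDist, ← Real.cos_neg (φ - θ), neg_sub]
  have h3 : m ^ 2 / Real.pi ^ 2 * (θ - φ) ^ 2
    = m * m * (2 / Real.pi ^ 2 * (θ - φ) ^ 2) / 2 := by ring
  rw [h3]
  nlinarith [sq_nonneg (lam * R φ - R θ)]

theorem sqDist_le {R : ℝ → ℝ} {M : ℝ} {lam φ θ : ℝ} (hlam0 : 0 ≤ lam) (hlam : lam ≤ 2)
    (hφ : R φ ∈ Icc 0 M) (hθ : R θ ∈ Icc 0 M) : sqDist R lam φ θ / 4 ≤ 9 / 4 * M ^ 2 := by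
  have hM : 0 ≤ M := hφ.1.trans hφ.2
  have h1 : lam * R φ ≤ 2 * M := mul_le_mul hlam hφ.2 hφ.1 (by norm_num)
  have h0 : 0 ≤ lam * R φ := mul_nonneg hlam0 hφ.1
  have h2 : -(lam * R φ * R θ * Real.cos (φ - θ)) ≤ lam * R φ * R θ := by
    have := mul_nonneg h0 hθ.1
    nlinarith [Real.neg_one_le_cos (φ - θ)]
  have h3 : (lam * R φ + R θ) ^ 2 ≤ (3 * M) ^ 2 := by
    have := hθ.1
    have := hθ.2
    gcongr
    linarith
  rw [sqDist]
  nlinarith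

theorem sq_layerWeight_le (R : ℝ → ℝ) (lam φ θ : ℝ) :
    layerWeight R lam φ θ ^ 2 ≤ sqDist R lam φ θ * (deriv R θ ^ 2 + R θ ^ 2) := by
  have h1 : deriv R θ ^ 2 + R θ ^ 2 = tangentY R θ ^ 2 + (-tangentX R θ) ^ 2 := by
    rw [tangentX, tangentY]
    linear_combination (-(deriv R θ ^ 2 + R θ ^ 2)) * Real.sin_sq_add_cos_sq θ
  rw [← inner_eq_layerWeight, ← add_sq_eq_sqDist, h1]
  nlinarith [sq_nonneg ((R θ * Real.cos θ - lam * R φ * Real.cos φ) * -tangentX R θ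
    - (R θ * Real.sin θ - lam * R φ * Real.sin φ) * tangentY R θ)]

theorem exists_layerIntegrand_curve_bound {μ : ℝ} (β : ℝ) {R : ℝ → ℝ} (hR : ContDiff ℝ 3 R)
    (hpos : ∀ θ, 0 < R θ) : ∃ C : ℝ, 0 ≤ C ∧ ∀ φ ∈ Icc (0 : ℝ) (2 * Real.pi),
      ∀ θ ∈ Icc (φ - Real.pi) (φ + Real.pi), θ ≠ φ →
      (∀ lam ∈ Icc (1 : ℝ) 2, 0 < sqDist R lam φ θ / 4 ∧
        |layerIntegrand μ β R φ θ (sqDist R lam φ θ / 4) (layerWeight R lam φ θ)|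
          ≤ C * |θ - φ| ^ (-(1 / 2) : ℝ)) ∧
      ∀ h, 0 < h → h ≤ 1 →
        |layerIntegrand μ β R φ θ (sqDist R 1 φ θ / 4 + h) (layerWeight R 1 φ θ)
          - layerIntegrand μ β R φ θ (sqDist R 1 φ θ / 4) (layerWeight R 1 φ θ)|
          ≤ C * h ^ (1 / 4 : ℝ) * |θ - φ| ^ (-(1 / 2) : ℝ) := by
  have hpi := Real.pi_pos
  set J := Icc (-Real.pi) (3 * Real.pi) with hJ
  have hJne : J.Nonempty := ⟨0, by constructor <;> linarith⟩
  have hκ := contDiff_curvature hR hpos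
  have hRc' : Continuous (deriv R) := hR.continuous_deriv (by norm_num)
  obtain ⟨θ₀, -, hmin⟩ := isCompact_Icc.exists_isMinOn hJne hR.continuous.continuousOn
  obtain ⟨M, hM⟩ := isCompact_Icc.exists_bound_of_continuousOn (hR.continuous.continuousOn (s := J))
  obtain ⟨S₀, hS₀⟩ := isCompact_Icc.exists_bound_of_continuousOn
    (Continuous.continuousOn (s := J) (f := fun θ => Real.sqrt (deriv R θ ^ 2 + R θ ^ 2))
      (by have := hR.continuous; fun_prop))
  obtain ⟨k₀, hk₀⟩ := isCompact_Icc.exists_bound_of_continuousOn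
    (Continuous.continuousOn (s := J) (f := fun θ => μ + curvature R θ)
      (continuous_const.add hκ.continuous))
  obtain ⟨L, hL⟩ := hκ.contDiffOn.exists_lipschitzOnWith one_ne_zero
    (convex_Icc (-Real.pi) (3 * Real.pi)) isCompact_Icc
  have hz : (0 : ℝ) ∈ J := by constructor <;> linarith
  have hM0 : 0 ≤ M := (norm_nonneg _).trans (hM 0 hz)
  have hS₀0 : 0 ≤ S₀ := (norm_nonneg _).trans (hS₀ 0 hz)
  have hk₀0 : 0 ≤ k₀ := (norm_nonneg _).trans (hk₀ 0 hz)
  set m := R θ₀ with hmdef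
  have hm0 : 0 < m := hpos θ₀
  set T := 9 / 4 * M ^ 2 + 1 with hTdef
  have hT0 : 0 < T := by positivity
  set e := m / Real.pi with he
  have he0 : 0 < e := by positivity
  set A := S₀ + k₀ + 2 * S₀ * Real.sqrt T + 2 * L * S₀ / e with hAdef
  obtain ⟨C, hC0, hC⟩ := exists_layerIntegrand_bound β hT0 (show 0 ≤ A by positivity)
  refine ⟨C * e ^ (-(1 / 2) : ℝ), by positivity, fun φ hφ θ hθ hne => ?_⟩
  have hφJ : φ ∈ J := ⟨by linarith [hφ.1], by linarith [hφ.2]⟩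
  have hθJ : θ ∈ J := ⟨by linarith [hφ.1, hθ.1], by linarith [hφ.2, hθ.2]⟩
  have hs : |θ - φ| ≤ Real.pi := by
    rw [abs_le]; constructor <;> linarith [hθ.1, hθ.2]
  have hs0 : 0 < |θ - φ| := abs_pos.2 (sub_ne_zero.2 hne)
  have hS := hS₀ θ hθJ
  have hk := hk₀ θ hθJ
  rw [Real.norm_eq_abs] at hS hk
  have hRM : ∀ θ ∈ J, R θ ∈ Icc 0 M := fun θ hθ =>
    ⟨(hpos θ).le, (le_abs_self _).trans (hM θ hθ)⟩
  have hd : |curvature R θ - curvature R φ| ≤ L * |θ - φ| := by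
    have := hL.dist_le_mul _ hθJ _ hφJ
    rwa [Real.dist_eq, Real.dist_eq] at this
  have hsqS : deriv R θ ^ 2 + R θ ^ 2 ≤ S₀ ^ 2 := by
    have h1 : 0 ≤ deriv R θ ^ 2 + R θ ^ 2 := by positivity
    rw [← Real.sq_sqrt h1]
    have := (le_abs_self _).trans hS
    gcongr
  have geo : ∀ lam ∈ Icc (1 : ℝ) 2, 0 < sqDist R lam φ θ / 4 ∧ sqDist R lam φ θ / 4 ≤ T - 1 ∧
      e * |θ - φ| ≤ Real.sqrt (sqDist R lam φ θ / 4) ∧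
      |layerWeight R lam φ θ| ≤ 2 * S₀ * Real.sqrt (sqDist R lam φ θ / 4) := by
    intro lam hlam
    have h1 := sqDist_ge hm0.le hlam.1 (hmin hφJ) (hmin hθJ) hs
    have h2 := sqDist_le (by linarith [hlam.1]) hlam.2 (hRM φ hφJ) (hRM θ hθJ)
    have h3 := sq_layerWeight_le R lam φ θ
    have hes : (e * |θ - φ|) ^ 2 = m ^ 2 / Real.pi ^ 2 * (θ - φ) ^ 2 := by
      rw [mul_pow, sq_abs, he, div_pow]
    have hpos' : 0 < sqDist R lam φ θ / 4 := lt_of_lt_of_le (by rw [← hes]; positivity) h1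
    refine ⟨hpos', by rw [hTdef]; linarith, ?_, ?_⟩
    · exact Real.le_sqrt_of_sq_le (by rw [hes]; exact h1)
    · refine abs_le_of_sq_le_sq ?_ (by positivity)
      rw [mul_pow, Real.sq_sqrt hpos'.le]
      have : sqDist R lam φ θ * (deriv R θ ^ 2 + R θ ^ 2) ≤ sqDist R lam φ θ * S₀ ^ 2 := by
        have : 0 ≤ sqDist R lam φ θ := by linarith
        gcongr
      linarith
  have hSA : |Real.sqrt (deriv R θ ^ 2 + R θ ^ 2)| ≤ A := by
    have : 0 ≤ k₀ + 2 * S₀ * Real.sqrt T + 2 * L * S₀ / e := by positivity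
    rw [hAdef]; linarith
  have hkA : |μ + curvature R θ| ≤ A := by
    have : 0 ≤ S₀ + 2 * S₀ * Real.sqrt T + 2 * L * S₀ / e := by positivity
    rw [hAdef]; linarith
  have hall : ∀ lam ∈ Icc (1 : ℝ) 2, |layerWeight R lam φ θ| ≤ A ∧
      |(curvature R θ - curvature R φ) * layerWeight R lam φ θ| ≤ A * (sqDist R lam φ θ / 4) ∧
      (sqDist R lam φ θ / 4) ^ (-(1 / 4) : ℝ) ≤ e ^ (-(1 / 2) : ℝ) * |θ - φ| ^ (-(1 / 2) : ℝ) := by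
    intro lam hlam
    obtain ⟨g1, g2, g3, g4⟩ := geo lam hlam
    set t := sqDist R lam φ θ / 4
    refine ⟨?_, ?_, ?_⟩
    · have h1 : Real.sqrt t ≤ Real.sqrt T := Real.sqrt_le_sqrt (by linarith)
      have h2 : 2 * S₀ * Real.sqrt t ≤ 2 * S₀ * Real.sqrt T := by gcongr
      have : 0 ≤ S₀ + k₀ + 2 * L * S₀ / e := by positivity
      rw [hAdef]; linarith
    · have h1 : |θ - φ| ≤ Real.sqrt t / e := by
        rw [le_div_iff₀ he0, mul_comm]; exact g3
      rw [abs_mul]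
      calc |curvature R θ - curvature R φ| * |layerWeight R lam φ θ|
          ≤ (L * (Real.sqrt t / e)) * (2 * S₀ * Real.sqrt t) := by
            gcongr
            exact hd.trans (by gcongr)
        _ = 2 * L * S₀ / e * (Real.sqrt t * Real.sqrt t) := by ring
        _ = 2 * L * S₀ / e * t := by rw [Real.mul_self_sqrt g1.le]
        _ ≤ A * t := by
            have : 0 ≤ S₀ + k₀ + 2 * S₀ * Real.sqrt T := by positivity
            gcongr
            rw [hAdef]; linarith
    · rw [← Real.mul_rpow he0.le hs0.le]
      have h1 : t ^ (-(1 / 4) : ℝ) = Real.sqrt t ^ (-(1 / 2) : ℝ) := by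
        rw [Real.sqrt_eq_rpow, ← Real.rpow_mul g1.le]; norm_num
      rw [h1]
      exact Real.rpow_le_rpow_of_nonpos (by positivity) g3 (by norm_num)
  refine ⟨fun lam hlam => ?_, fun h hh hh1 => ?_⟩
  · obtain ⟨g1, g2, -, -⟩ := geo lam hlam
    obtain ⟨a1, a2, a3⟩ := hall lam hlam
    refine ⟨g1, ((hC _ _ _ _ _ hSA hkA a1 g1 a2).1 (by linarith)).trans ?_⟩
    rw [mul_assoc]
    gcongr
  · have hone : (1 : ℝ) ∈ Icc (1 : ℝ) 2 := ⟨le_rfl, one_le_two⟩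
    obtain ⟨g1, g2, -, -⟩ := geo 1 hone
    obtain ⟨a1, a2, a3⟩ := hall 1 hone
    refine ((hC _ _ _ _ _ hSA hkA a1 g1 a2).2 h hh (by linarith)).trans ?_
    rw [Real.div_rpow hh.le g1.le, div_eq_mul_inv, ← Real.rpow_neg g1.le]
    calc C * (h ^ (1 / 4 : ℝ) * (sqDist R 1 φ θ / 4) ^ (-(1 / 4) : ℝ))
        ≤ C * (h ^ (1 / 4 : ℝ) * (e ^ (-(1 / 2) : ℝ) * |θ - φ| ^ (-(1 / 2) : ℝ))) := by gcongr
      _ = _ := by ring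

theorem intervalIntegrable_abs_rpow {r a : ℝ} (hr : -1 < r) (ha : 0 ≤ a) :
    IntervalIntegrable (fun s : ℝ => |s| ^ r) volume (-a) a := by
  have h1 : IntervalIntegrable (fun s : ℝ => |s| ^ r) volume 0 a := by
    refine (intervalIntegral.intervalIntegrable_rpow' hr).congr fun s hs => ?_
    rw [uIoc_of_le ha] at hs
    simp only [abs_of_pos hs.1]
  have h2 : IntervalIntegrable (fun s : ℝ => |s| ^ r) volume (-a) 0 := by
    have := (IntervalIntegrable.iff_comp_neg (f := fun s : ℝ => |s| ^ r)).1 h1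
    simpa using this.symm
  exact h2.trans h1

theorem regDist_sq (R : ℝ → ℝ) {τ : ℝ} (hτ : 0 < τ) (φ θ : ℝ) :
    0 < regDist τ R φ θ ∧ regDist τ R φ θ ^ 2 / 4 = sqDist R 1 φ θ / 4 + τ ^ 2 / 4 := by
  have h0 : 0 ≤ sqDist R 1 φ θ := by rw [← add_sq_eq_sqDist]; positivity
  have h1 : R φ ^ 2 + R θ ^ 2 - 2 * R φ * R θ * Real.cos (φ - θ) + τ ^ 2
      = sqDist R 1 φ θ + τ ^ 2 := by rw [sqDist]; ring
  have h2 : 0 < sqDist R 1 φ θ + τ ^ 2 := by positivity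
  rw [regDist, h1]
  refine ⟨Real.sqrt_pos.2 h2, ?_⟩
  rw [Real.sq_sqrt h2.le]
  ring

theorem boundaryOp_eq (μ β : ℝ) {τ : ℝ} (hτ : 0 < τ) (R : ℝ → ℝ) (φ : ℝ) :
    boundaryOp μ β τ R φ = ∫ θ in (0 : ℝ)..(2 * Real.pi),
      layerIntegrand μ β R φ θ (sqDist R 1 φ θ / 4 + τ ^ 2 / 4) (layerWeight R 1 φ θ) := by
  refine intervalIntegral.integral_congr fun θ _ => ?_
  obtain ⟨h1, h2⟩ := regDist_sq R hτ φ θ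
  have h3 : 8 * Real.pi * (sqDist R 1 φ θ / 4 + τ ^ 2 / 4)
      = 2 * Real.pi * regDist τ R φ θ ^ 2 := by rw [← h2]; ring
  simp only [layerIntegrand, greenG_eq h1, kernelQ_eq h1, h2, h3, layerWeight, one_mul]

theorem continuous_layerIntegrand (μ β : ℝ) {R : ℝ → ℝ} (hR : ContDiff ℝ 3 R)
    (hpos : ∀ θ, 0 < R θ) (φ : ℝ) {t w : ℝ → ℝ} (ht : Continuous t) (hw : Continuous w)
    (ht0 : ∀ θ, 0 < t θ) : Continuous fun θ => layerIntegrand μ β R φ θ (t θ) (w θ) := by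
  have hκ := (contDiff_curvature hR hpos).continuous
  have hRc := hR.continuous
  have hRc' : Continuous (deriv R) := hR.continuous_deriv (by norm_num)
  have hg := logSingular_greenT.continuousOn.comp_continuous ht ht0
  have hq := logSingular_kernelT.continuousOn.comp_continuous ht ht0
  have hS : Continuous fun θ => Real.sqrt (deriv R θ ^ 2 + R θ ^ 2) := by fun_prop
  have hfrac : Continuous fun θ => (curvature R θ - curvature R φ) / (8 * Real.pi * t θ) :=
    (hκ.sub continuous_const).div (continuous_const.mul ht)
      fun θ => (mul_pos (by positivity) (ht0 θ)).ne'
  exact ((continuous_const.mul hg).mul hS).sub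
    ((((continuous_const.add hκ).mul hq).sub hfrac).mul hw)

theorem periodic_layerIntegrand (μ β : ℝ) {R : ℝ → ℝ} (hR : Function.Periodic R (2 * Real.pi))
    (lam φ h : ℝ) : Function.Periodic (fun θ => layerIntegrand μ β R φ θ
      (sqDist R lam φ θ / 4 + h) (layerWeight R lam φ θ)) (2 * Real.pi) := by
  intro θ
  simp only [layerIntegrand, sqDist, layerWeight, hR θ, periodic_deriv hR θ, periodic_curvature hR θ,
    ← sub_sub, Real.cos_sub_two_pi, Real.sin_sub_two_pi]

theorem continuous_sqDist {R : ℝ → ℝ} (hR : Continuous R) (lam φ : ℝ) :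
    Continuous fun θ => sqDist R lam φ θ := by
  unfold sqDist; fun_prop

theorem continuous_layerWeight {R : ℝ → ℝ} (hR : ContDiff ℝ 3 R) (lam φ : ℝ) :
    Continuous fun θ => layerWeight R lam φ θ := by
  have hRc := hR.continuous
  have hRc' : Continuous (deriv R) := hR.continuous_deriv (by norm_num)
  unfold layerWeight; fun_prop

theorem tendsto_layerIntegrand (μ β : ℝ) (R : ℝ → ℝ) {φ θ : ℝ} (h : 0 < sqDist R 1 φ θ / 4) :
    Tendsto (fun lam => layerIntegrand μ β R φ θ (sqDist R lam φ θ / 4) (layerWeight R lam φ θ))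
      (𝓝 1) (𝓝 (layerIntegrand μ β R φ θ (sqDist R 1 φ θ / 4) (layerWeight R 1 φ θ))) := by
  have hd : Continuous fun lam => sqDist R lam φ θ / 4 := by unfold sqDist; fun_prop
  have hw : Continuous fun lam => layerWeight R lam φ θ := by unfold layerWeight; fun_prop
  have hg : Tendsto (fun lam => greenT (sqDist R lam φ θ / 4)) (𝓝 1)
      (𝓝 (greenT (sqDist R 1 φ θ / 4))) :=
    (logSingular_greenT.continuousOn.continuousAt (Ioi_mem_nhds h)).tendsto.comp (hd.tendsto 1)
  have hq : Tendsto (fun lam => kernelT (sqDist R lam φ θ / 4)) (𝓝 1)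
      (𝓝 (kernelT (sqDist R 1 φ θ / 4))) :=
    (logSingular_kernelT.continuousOn.continuousAt (Ioi_mem_nhds h)).tendsto.comp (hd.tendsto 1)
  have hne : 8 * Real.pi * (sqDist R 1 φ θ / 4) ≠ 0 := by positivity
  exact ((hg.const_mul β).mul_const _).sub (((hq.const_mul _).sub
    (tendsto_const_nhds.div ((hd.tendsto 1).const_mul _) hne)).mul (hw.tendsto 1))

/-- On the boundary of a solution the regularized operator is of order `τ ^ (1 / 2)`. -/
theorem exists_abs_boundaryOp_le {μ β : ℝ} {R : ℝ → ℝ} (hR : IsSolutionBoundary μ β R) :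
    ∃ C : ℝ, 0 ≤ C ∧ ∀ τ, 0 < τ → τ ≤ 1 → ∀ φ ∈ Icc (0 : ℝ) (2 * Real.pi),
      |boundaryOp μ β τ R φ| ≤ C * τ ^ (1 / 2 : ℝ) := by
  have hpi := Real.pi_pos
  obtain ⟨C, hC0, hC⟩ := exists_layerIntegrand_curve_bound (μ := μ) β hR.contDiff hR.pos
  set I₀ := ∫ s in (-Real.pi)..Real.pi, |s| ^ (-(1 / 2) : ℝ) with hI₀
  have hI₀0 : 0 ≤ I₀ := intervalIntegral.integral_nonneg (by linarith) fun s _ => by positivity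
  refine ⟨C * I₀, by positivity, fun τ hτ hτ1 φ hφ => ?_⟩
  set h := τ ^ 2 / 4 with hh
  have hh0 : 0 < h := by positivity
  have hh1 : h ≤ 1 := by rw [hh]; nlinarith
  have hhτ : h ^ (1 / 4 : ℝ) ≤ τ ^ (1 / 2 : ℝ) := by
    calc h ^ (1 / 4 : ℝ) ≤ (τ ^ 2) ^ (1 / 4 : ℝ) := by
          gcongr; rw [hh]; nlinarith
      _ = τ ^ (1 / 2 : ℝ) := by
          rw [← Real.rpow_natCast, ← Real.rpow_mul hτ.le]; norm_num
  let A : ℝ → ℝ := fun θ =>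
    layerIntegrand μ β R φ θ (sqDist R 1 φ θ / 4 + h) (layerWeight R 1 φ θ)
  let B : ℝ → ℝ → ℝ := fun lam θ =>
    layerIntegrand μ β R φ θ (sqDist R lam φ θ / 4) (layerWeight R lam φ θ)
  have hshift : ∀ f : ℝ → ℝ, Function.Periodic f (2 * Real.pi) →
      ∫ θ in (0 : ℝ)..(2 * Real.pi), f θ = ∫ θ in (φ - Real.pi)..(φ + Real.pi), f θ := by
    intro f hf
    have := hf.intervalIntegral_add_eq 0 (φ - Real.pi)
    rw [zero_add, show φ - Real.pi + 2 * Real.pi = φ + Real.pi by ring] at this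
    exact this
  have hAc : Continuous A := continuous_layerIntegrand μ β hR.contDiff hR.pos φ
    (((continuous_sqDist hR.contDiff.continuous 1 φ).div_const 4).add continuous_const)
    (continuous_layerWeight hR.contDiff 1 φ) fun θ => by
      have : 0 ≤ sqDist R 1 φ θ := by rw [← add_sq_eq_sqDist]; positivity
      positivity
  have hBc : ∀ lam, 1 < lam → Continuous (B lam) := fun lam hl =>
    (integral_layerIntegrand_eq_zero hR hl φ).1
  have hB0 : ∀ lam, 1 < lam → ∫ θ in (φ - Real.pi)..(φ + Real.pi), B lam θ = 0 := by
    intro lam hl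
    rw [← hshift _ (by simpa using periodic_layerIntegrand μ β hR.periodic lam φ 0)]
    exact (integral_layerIntegrand_eq_zero hR hl φ).2
  have hwt : IntervalIntegrable (fun θ => |θ - φ| ^ (-(1 / 2) : ℝ)) volume (φ - Real.pi)
      (φ + Real.pi) := by
    have := (intervalIntegrable_abs_rpow (r := -(1 / 2)) (by norm_num) hpi.le).comp_sub_right φ
    rwa [neg_add_eq_sub, add_comm] at this
  have hwti : ∫ θ in (φ - Real.pi)..(φ + Real.pi), |θ - φ| ^ (-(1 / 2) : ℝ) = I₀ := by
    rw [intervalIntegral.integral_comp_sub_right (fun s => |s| ^ (-(1 / 2) : ℝ)), hI₀]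
    congr 1 <;> ring
  have hle : φ - Real.pi ≤ φ + Real.pi := by linarith
  have hae : ∀ᵐ θ : ℝ, θ ≠ φ := by
    rw [ae_iff]; simp
  have key : boundaryOp μ β τ R φ = ∫ θ in (φ - Real.pi)..(φ + Real.pi), (A θ - B 1 θ) := by
    rw [boundaryOp_eq μ β hτ, hshift _ (periodic_layerIntegrand μ β hR.periodic 1 φ h)]
    let lam : ℕ → ℝ := fun n => 1 + 1 / ((n : ℝ) + 1)
    have hlam1 : ∀ n, 1 < lam n := fun n => by
      have : 0 < 1 / ((n : ℝ) + 1) := by positivity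
      simp only [lam]; linarith
    have hlam2 : ∀ n, lam n ∈ Icc (1 : ℝ) 2 := fun n => by
      have : 1 / ((n : ℝ) + 1) ≤ 1 := by
        rw [div_le_one (by positivity)]; linarith [Nat.cast_nonneg (α := ℝ) n]
      exact ⟨(hlam1 n).le, by simp only [lam]; linarith⟩
    have hlim : Tendsto lam atTop (𝓝 1) := by
      have := (tendsto_const_nhds (x := (1 : ℝ))).add
        (tendsto_one_div_add_atTop_nhds_zero_nat (𝕜 := ℝ))
      rwa [add_zero] at this
    have hdom := intervalIntegral.tendsto_integral_filter_of_dominated_convergence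
      (μ := volume) (a := φ - Real.pi) (b := φ + Real.pi) (l := atTop)
      (F := fun n θ => A θ - B (lam n) θ) (f := fun θ => A θ - B 1 θ)
      (fun θ => 3 * C * |θ - φ| ^ (-(1 / 2) : ℝ))
      (Eventually.of_forall fun n => (hAc.sub (hBc _ (hlam1 n))).aestronglyMeasurable)
      (Eventually.of_forall fun n => by
        filter_upwards [hae] with θ hne hθ
        rw [uIoc_of_le hle] at hθ
        obtain ⟨c1, c2⟩ := hC φ hφ θ (Ioc_subset_Icc_self hθ) hne
        have b1 := (c1 (lam n) (hlam2 n)).2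
        have b2 := (c1 1 ⟨le_rfl, one_le_two⟩).2
        have b3 := c2 h hh0 hh1
        have b4 : C * h ^ (1 / 4 : ℝ) * |θ - φ| ^ (-(1 / 2) : ℝ)
            ≤ C * 1 * |θ - φ| ^ (-(1 / 2) : ℝ) := by
          gcongr
          exact Real.rpow_le_one hh0.le hh1 (by norm_num)
        rw [Real.norm_eq_abs]
        calc |A θ - B (lam n) θ| = |(A θ - B 1 θ) + B 1 θ + -B (lam n) θ| := by ring_nf
          _ ≤ |A θ - B 1 θ| + |B 1 θ| + |-B (lam n) θ| := abs_add_three _ _ _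
          _ ≤ _ := by
            rw [abs_neg]
            linarith [b1, b2, b3, b4])
      (hwt.const_mul _)
      (by
        filter_upwards [hae] with θ hne hθ
        rw [uIoc_of_le hle] at hθ
        obtain ⟨c1, -⟩ := hC φ hφ θ (Ioc_subset_Icc_self hθ) hne
        exact tendsto_const_nhds.sub ((tendsto_layerIntegrand μ β R
          (c1 1 ⟨le_rfl, one_le_two⟩).1).comp hlim))
    refine tendsto_nhds_unique (tendsto_const_nhds.congr fun n => ?_) hdom
    rw [intervalIntegral.integral_sub (hAc.intervalIntegrable _ _)
      ((hBc _ (hlam1 n)).intervalIntegrable _ _), hB0 _ (hlam1 n), sub_zero]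
  rw [key, ← Real.norm_eq_abs]
  refine (intervalIntegral.norm_integral_le_of_norm_le hle (g := fun θ =>
    C * h ^ (1 / 4 : ℝ) * |θ - φ| ^ (-(1 / 2) : ℝ)) ?_ (hwt.const_mul _)).trans ?_
  · filter_upwards [hae] with θ hne hθ
    exact (hC φ hφ θ (Ioc_subset_Icc_self hθ) hne).2 h hh0 hh1
  · rw [intervalIntegral.integral_const_mul, hwti]
    calc C * h ^ (1 / 4 : ℝ) * I₀ ≤ C * τ ^ (1 / 2 : ℝ) * I₀ := by gcongr
      _ = _ := by ring

/-! Continuity of the regularized operator in `C²` -/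

/-- Curvature as a function of the 2-jet. -/
def jetCurvature (p : ℝ × ℝ × ℝ) : ℝ :=
  (p.1 ^ 2 + 2 * p.2.1 ^ 2 - p.1 * p.2.2) / (p.1 ^ 2 + p.2.1 ^ 2) ^ (3 / 2 : ℝ)

/-- Regularized distance as a function of the parameters and the values of the radius. -/
def jetDist (τ φ θ a b : ℝ) : ℝ :=
  Real.sqrt (a ^ 2 + b ^ 2 - 2 * a * b * Real.cos (φ - θ) + τ ^ 2)

/-- The integrand of the regularized operator as a function of the parameters `φ`, `θ` and of the
2-jets `p`, `q` of the radius at these parameters. -/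
def jetIntegrand (μ β τ : ℝ) (x : (ℝ × ℝ) × (ℝ × ℝ × ℝ) × (ℝ × ℝ × ℝ)) : ℝ :=
  let φ := x.1.1
  let θ := x.1.2
  let p := x.2.1
  let q := x.2.2
  β * greenG (jetDist τ φ θ p.1 q.1) * Real.sqrt (q.2.1 ^ 2 + q.1 ^ 2)
    - ((μ + jetCurvature q) * kernelQ (jetDist τ φ θ p.1 q.1)
        - (jetCurvature q - jetCurvature p) / (2 * Real.pi * jetDist τ φ θ p.1 q.1 ^ 2))
      * (q.1 ^ 2 + p.1 * q.2.1 * Real.sin (φ - θ) - p.1 * q.1 * Real.cos (φ - θ))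

/-- The 2-jet of a function. -/
def jet (R : ℝ → ℝ) (θ : ℝ) : ℝ × ℝ × ℝ := (R θ, deriv R θ, iteratedDeriv 2 R θ)

theorem boundaryOp_eq_jet (μ β τ : ℝ) (R : ℝ → ℝ) (φ : ℝ) : boundaryOp μ β τ R φ =
    ∫ θ in (0 : ℝ)..(2 * Real.pi), jetIntegrand μ β τ ((φ, θ), jet R φ, jet R θ) := rfl

theorem continuous_jet {R : ℝ → ℝ} (hR : ContDiff ℝ 2 R) : Continuous (jet R) :=
  hR.continuous.prodMk ((hR.continuous_deriv one_le_two).prodMk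
    (hR.continuous_iteratedDeriv 2 le_rfl))

theorem continuousOn_greenG : ContinuousOn greenG (Ioi 0) := by
  have h : ContinuousOn (fun r : ℝ => greenT (r ^ 2 / 4)) (Ioi 0) :=
    logSingular_greenT.continuousOn.comp (by fun_prop)
      fun r (hr : 0 < r) => (by positivity : 0 < r ^ 2 / 4)
  exact h.congr fun r hr => greenG_eq hr

theorem continuousOn_kernelQ : ContinuousOn kernelQ (Ioi 0) := by
  have h : ContinuousOn (fun r : ℝ => kernelT (r ^ 2 / 4)) (Ioi 0) :=
    logSingular_kernelT.continuousOn.comp (by fun_prop)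
      fun r (hr : 0 < r) => (by positivity : 0 < r ^ 2 / 4)
  exact h.congr fun r hr => kernelQ_eq hr

theorem jetDist_pos {τ : ℝ} (hτ : 0 < τ) (φ θ a b : ℝ) : 0 < jetDist τ φ θ a b := by
  refine Real.sqrt_pos.2 ?_
  have h1 : a ^ 2 + b ^ 2 - 2 * a * b * Real.cos (φ - θ)
      = (a - b * Real.cos (φ - θ)) ^ 2 + (b * Real.sin (φ - θ)) ^ 2 := by
    linear_combination (-b ^ 2) * Real.sin_sq_add_cos_sq (φ - θ)
  rw [h1]
  positivity

theorem continuousOn_jetIntegrand (μ β : ℝ) {τ : ℝ} (hτ : 0 < τ) :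
    ContinuousOn (jetIntegrand μ β τ) {x | 0 < x.2.1.1 ∧ 0 < x.2.2.1} := by
  set s := {x : (ℝ × ℝ) × (ℝ × ℝ × ℝ) × (ℝ × ℝ × ℝ) | 0 < x.2.1.1 ∧ 0 < x.2.2.1}
  have hd : Continuous fun x : (ℝ × ℝ) × (ℝ × ℝ × ℝ) × (ℝ × ℝ × ℝ) =>
      jetDist τ x.1.1 x.1.2 x.2.1.1 x.2.2.1 := by unfold jetDist; fun_prop
  have hd0 : ∀ x : (ℝ × ℝ) × (ℝ × ℝ × ℝ) × (ℝ × ℝ × ℝ),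
      0 < jetDist τ x.1.1 x.1.2 x.2.1.1 x.2.2.1 := fun x => jetDist_pos hτ _ _ _ _
  have hg := continuousOn_greenG.comp_continuous hd hd0
  have hq := continuousOn_kernelQ.comp_continuous hd hd0
  have hκ : ContinuousOn jetCurvature {p | 0 < p.1} := by
    have hpos : ∀ p ∈ {p : ℝ × ℝ × ℝ | 0 < p.1}, 0 < p.1 ^ 2 + p.2.1 ^ 2 := fun p hp => by
      have : 0 < p.1 := hp
      positivity
    refine ContinuousOn.div (by fun_prop) ?_ fun p hp => (Real.rpow_pos_of_pos (hpos p hp) _).ne'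
    exact ContinuousOn.rpow_const (by fun_prop) fun p hp => Or.inl (hpos p hp).ne'
  have hκp : ContinuousOn (fun x : (ℝ × ℝ) × (ℝ × ℝ × ℝ) × (ℝ × ℝ × ℝ) => jetCurvature x.2.1) s :=
    hκ.comp (by fun_prop) fun x hx => hx.1
  have hκq : ContinuousOn (fun x : (ℝ × ℝ) × (ℝ × ℝ × ℝ) × (ℝ × ℝ × ℝ) => jetCurvature x.2.2) s :=
    hκ.comp (by fun_prop) fun x hx => hx.2
  have hfrac : ContinuousOn (fun x : (ℝ × ℝ) × (ℝ × ℝ × ℝ) × (ℝ × ℝ × ℝ) =>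
      (jetCurvature x.2.2 - jetCurvature x.2.1)
        / (2 * Real.pi * jetDist τ x.1.1 x.1.2 x.2.1.1 x.2.2.1 ^ 2)) s :=
    (hκq.sub hκp).div (continuous_const.mul (hd.pow 2)).continuousOn fun x _ => by
      have := hd0 x
      positivity
  have hS : Continuous fun x : (ℝ × ℝ) × (ℝ × ℝ × ℝ) × (ℝ × ℝ × ℝ) =>
    Real.sqrt (x.2.2.2.1 ^ 2 + x.2.2.1 ^ 2) := by fun_prop
  have hw : Continuous fun x : (ℝ × ℝ) × (ℝ × ℝ × ℝ) × (ℝ × ℝ × ℝ) =>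
    x.2.2.1 ^ 2 + x.2.1.1 * x.2.2.2.1 * Real.sin (x.1.1 - x.1.2)
      - x.2.1.1 * x.2.2.1 * Real.cos (x.1.1 - x.1.2) := by fun_prop
  exact ((continuous_const.mul hg).mul hS).continuousOn.sub
    ((((continuousOn_const.add hκq).mul hq.continuousOn).sub hfrac).mul hw.continuousOn)

theorem exists_boundaryOp_near (μ β : ℝ) {τ : ℝ} (hτ : 0 < τ) {R : ℝ → ℝ} (hR : ContDiff ℝ 2 R)
    (hpos : ∀ θ ∈ Icc (0 : ℝ) (2 * Real.pi), 0 < R θ) {ε : ℝ} (hε : 0 < ε) :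
    ∃ η > 0, ∀ ρ : ℝ → ℝ, ContDiff ℝ 2 ρ →
      (∀ α ≤ 2, ∀ θ ∈ Icc (0 : ℝ) (2 * Real.pi),
        |iteratedDeriv α ρ θ - iteratedDeriv α R θ| ≤ η) →
      (∀ θ ∈ Icc (0 : ℝ) (2 * Real.pi), 0 < ρ θ) ∧
      ∀ φ ∈ Icc (0 : ℝ) (2 * Real.pi), |boundaryOp μ β τ ρ φ - boundaryOp μ β τ R φ| ≤ ε := by
  have hpi := Real.pi_pos
  set J := Icc (0 : ℝ) (2 * Real.pi)
  have hz : (0 : ℝ) ∈ J := ⟨le_rfl, by positivity⟩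
  obtain ⟨θ₀, hθ₀, hmin⟩ := isCompact_Icc.exists_isMinOn ⟨0, hz⟩ hR.continuous.continuousOn
  obtain ⟨M, hM⟩ := isCompact_Icc.exists_bound_of_continuousOn
    ((continuous_jet hR).continuousOn (s := J))
  set m := R θ₀
  have hm0 : 0 < m := hpos θ₀ hθ₀
  let B : Set (ℝ × ℝ × ℝ) := Icc (m / 2) (M + 1) ×ˢ Icc (-(M + 1)) (M + 1) ×ˢ Icc (-(M + 1)) (M + 1)
  have hK : IsCompact ((J ×ˢ J) ×ˢ (B ×ˢ B)) :=
    (isCompact_Icc.prod isCompact_Icc).prod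
      ((isCompact_Icc.prod (isCompact_Icc.prod isCompact_Icc)).prod
        (isCompact_Icc.prod (isCompact_Icc.prod isCompact_Icc)))
  have hcont : ContinuousOn (jetIntegrand μ β τ) ((J ×ˢ J) ×ˢ (B ×ˢ B)) :=
    (continuousOn_jetIntegrand μ β hτ).mono fun x hx =>
      ⟨(half_pos hm0).trans_le hx.2.1.1.1, (half_pos hm0).trans_le hx.2.2.1.1⟩
  obtain ⟨η₀, hη₀, hunif⟩ := Metric.uniformContinuousOn_iff.1
    (hK.uniformContinuousOn_of_continuous hcont) (ε / (2 * Real.pi)) (by positivity)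
  have hjet : ∀ (η : ℝ) (ρ : ℝ → ℝ), (∀ α ≤ 2, ∀ θ ∈ J,
      |iteratedDeriv α ρ θ - iteratedDeriv α R θ| ≤ η) → ∀ θ ∈ J,
      |ρ θ - R θ| ≤ η ∧ |deriv ρ θ - deriv R θ| ≤ η ∧
        |iteratedDeriv 2 ρ θ - iteratedDeriv 2 R θ| ≤ η := by
    intro η ρ h θ hθ
    have h0 := h 0 (by norm_num) θ hθ
    have h1 := h 1 (by norm_num) θ hθ
    simp only [iteratedDeriv_zero, iteratedDeriv_one] at h0 h1
    exact ⟨h0, h1, h 2 le_rfl θ hθ⟩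
  have hB : ∀ (η : ℝ) (ρ : ℝ → ℝ), η ≤ m / 2 → η ≤ 1 → (∀ α ≤ 2, ∀ θ ∈ J,
      |iteratedDeriv α ρ θ - iteratedDeriv α R θ| ≤ η) → ∀ θ ∈ J, jet ρ θ ∈ B := by
    intro η ρ h1 h2 h θ hθ
    obtain ⟨j0, j1, j2⟩ := hjet η ρ h θ hθ
    have hm : m ≤ R θ := hmin hθ
    have hn := hM θ hθ
    rw [jet, Prod.norm_def, Prod.norm_def] at hn
    obtain ⟨n0, n12⟩ := max_le_iff.1 hn
    obtain ⟨n1, n2⟩ := max_le_iff.1 n12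
    simp only [Real.norm_eq_abs] at n0 n1 n2
    rw [abs_le] at j0 j1 j2 n0 n1 n2
    refine ⟨⟨?_, ?_⟩, ⟨?_, ?_⟩, ⟨?_, ?_⟩⟩ <;> simp only [jet] <;> linarith
  set η := min (η₀ / 2) (min (m / 2) 1) with hη
  have hη0 : 0 < η := by positivity
  have hη1 : η < η₀ := (min_le_left _ _).trans_lt (by linarith)
  have hη2 : η ≤ m / 2 := (min_le_right _ _).trans (min_le_left _ _)
  have hη3 : η ≤ 1 := (min_le_right _ _).trans (min_le_right _ _)
  refine ⟨η, hη0, fun ρ hρ hclose => ?_⟩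
  have hρB := hB η ρ hη2 hη3 hclose
  have hRB := hB η R hη2 hη3 (fun α _ θ _ => by simpa using hη0.le)
  refine ⟨fun θ hθ => (half_pos hm0).trans_le (hρB θ hθ).1.1, fun φ hφ => ?_⟩
  have hci : ∀ f : ℝ → ℝ, ContDiff ℝ 2 f → (∀ θ ∈ J, jet f θ ∈ B) → IntervalIntegrable
      (fun θ => jetIntegrand μ β τ ((φ, θ), jet f φ, jet f θ)) volume 0 (2 * Real.pi) := by
    intro f hf hfB
    have hj := continuous_jet hf
    refine ContinuousOn.intervalIntegrable ?_
    rw [uIcc_of_le (by positivity)]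
    exact hcont.comp (f := fun θ => ((φ, θ), jet f φ, jet f θ)) (by fun_prop)
      fun θ hθ => ⟨⟨hφ, hθ⟩, hfB φ hφ, hfB θ hθ⟩
  have hdist : ∀ θ ∈ J, dist (jet ρ θ) (jet R θ) ≤ η := by
    intro θ hθ
    obtain ⟨j0, j1, j2⟩ := hjet η ρ hclose θ hθ
    rw [jet, jet, Prod.dist_eq, Prod.dist_eq]
    exact max_le j0 (max_le j1 j2)
  rw [boundaryOp_eq_jet, boundaryOp_eq_jet,
    ← intervalIntegral.integral_sub (hci ρ hρ hρB) (hci R hR hRB), ← Real.norm_eq_abs]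
  refine (intervalIntegral.norm_integral_le_of_norm_le_const (C := ε / (2 * Real.pi))
    fun θ hθ => ?_).trans ?_
  · rw [uIoc_of_le (by positivity)] at hθ
    have hθ' : θ ∈ J := Ioc_subset_Icc_self hθ
    refine (hunif ((φ, θ), jet ρ φ, jet ρ θ) ⟨⟨hφ, hθ'⟩, hρB φ hφ, hρB θ hθ'⟩
      ((φ, θ), jet R φ, jet R θ) ⟨⟨hφ, hθ'⟩, hRB φ hφ, hRB θ hθ'⟩ ?_).le
    refine lt_of_le_of_lt (max_le ?_ (max_le (hdist φ hφ) (hdist θ hθ'))) hη1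
    simpa using hη0.le
  · rw [sub_zero, abs_of_pos (by positivity)]
    exact (div_mul_cancel₀ _ (by positivity)).le

theorem periodic_iteratedDeriv {f : ℝ → ℝ} {T : ℝ} (hf : Function.Periodic f T) (n : ℕ) :
    Function.Periodic (iteratedDeriv n f) T := by
  induction n with
  | zero => simpa using hf
  | succ n ih => rw [iteratedDeriv_succ]; exact periodic_deriv ih

theorem integral_sq_mul_density_le {f ν : ℝ → ℝ} (hν : IsDensity ν) {C : ℝ}
    (hf : ∀ φ ∈ Icc (0 : ℝ) (2 * Real.pi), |f φ| ≤ C) :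
    ∫ φ in (0 : ℝ)..(2 * Real.pi), f φ ^ 2 * ν φ ≤ C ^ 2 := by
  have h2pi : (0 : ℝ) ≤ 2 * Real.pi := by positivity
  have := intervalIntegral.norm_integral_le_of_norm_le (μ := volume) h2pi
    (f := fun φ => f φ ^ 2 * ν φ) (g := fun φ => C ^ 2 * ν φ)
    (Eventually.of_forall fun φ hφ => by
      have hφ' := Ioc_subset_Icc_self hφ
      have h0 := hν.nonneg φ hφ'
      rw [Real.norm_eq_abs, abs_of_nonneg (by positivity), ← sq_abs]
      gcongr
      exact hf φ hφ') (hν.integrable.const_mul _)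
  rw [intervalIntegral.integral_const_mul, hν.integral_eq_one, mul_one] at this
  exact (le_abs_self _).trans this

theorem penalty_le {R ρ : ℝ → ℝ} (hR : Function.Periodic R (2 * Real.pi)) {δ : ℝ}
    (h : ∀ α ≤ 2, ∀ θ ∈ Icc (0 : ℝ) (2 * Real.pi),
      |iteratedDeriv α ρ θ - iteratedDeriv α R θ| ≤ δ) :
    ∑ α ∈ Finset.range 3, (iteratedDeriv α ρ 0 - iteratedDeriv α ρ (2 * Real.pi)) ^ 2
      ≤ 12 * δ ^ 2 := by
  have h2pi : (0 : ℝ) ≤ 2 * Real.pi := by positivity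
  have hterm : ∀ α ∈ Finset.range 3,
      (iteratedDeriv α ρ 0 - iteratedDeriv α ρ (2 * Real.pi)) ^ 2 ≤ 4 * δ ^ 2 := by
    intro α hα
    have hα' : α ≤ 2 := by have := Finset.mem_range.1 hα; omega
    have h0 := h α hα' 0 ⟨le_rfl, h2pi⟩
    have h1 := h α hα' (2 * Real.pi) ⟨h2pi, le_rfl⟩
    have hp := periodic_iteratedDeriv hR α 0
    rw [zero_add] at hp
    rw [hp] at h1
    rw [abs_le] at h0 h1
    have : |iteratedDeriv α ρ 0 - iteratedDeriv α ρ (2 * Real.pi)| ≤ 2 * δ := by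
      rw [abs_le]; constructor <;> linarith
    calc (iteratedDeriv α ρ 0 - iteratedDeriv α ρ (2 * Real.pi)) ^ 2
        = |iteratedDeriv α ρ 0 - iteratedDeriv α ρ (2 * Real.pi)| ^ 2 := (sq_abs _).symm
      _ ≤ (2 * δ) ^ 2 := by gcongr
      _ = 4 * δ ^ 2 := by ring
  refine (Finset.sum_le_card_nsmul _ _ _ hterm).trans (le_of_eq ?_)
  rw [Finset.card_range, nsmul_eq_mul]
  push_cast
  ring

end HeleShaw
end

theorem theorem3p1 (μ β : ℝ) (hμ : 0 < μ) (hβ : 0 < β)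
    (Ψ : ℝ → ℝ) (hΨ : ContDiff ℝ 3 Ψ) (hΨ_bdd : ∃ M : ℝ, ∀ x, |Ψ x| ≤ M)
    (hΨ_nonconst : ¬ ∃ c : ℝ, ∀ x, Ψ x = c)
    (R : ℝ → ℝ) (hR : HeleShaw.IsSolutionBoundary μ β R)
    (ν : ℝ → ℝ) (hν : HeleShaw.IsDensity ν) :
    ∃ K : ℝ, 0 < K ∧ ∀ δ : ℝ, 0 < δ → δ < 1 →
      ∃ N : ℕ, 1 ≤ N ∧ ∃ ρ ∈ HeleShaw.networks Ψ N,
        (∀ θ ∈ Set.Icc (0 : ℝ) (2 * Real.pi), 0 < ρ θ) ∧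
        (∀ α ≤ 3, ∀ θ ∈ Set.Icc (0 : ℝ) (2 * Real.pi),
          |iteratedDeriv α ρ θ - iteratedDeriv α R θ| ≤ δ) ∧
        HeleShaw.loss μ β (δ ^ (1 / 8 : ℝ)) ν ρ ≤ K * δ ^ (1 / 8 : ℝ) := by
  obtain ⟨C, hC0, hC⟩ := HeleShaw.exists_abs_boundaryOp_le hR
  refine ⟨(C + 1) ^ 2 + 12, by positivity, fun δ hδ0 hδ1 => ?_⟩
  set τ := δ ^ (1 / 8 : ℝ) with hτ
  have hτ0 : 0 < τ := by positivity
  have hτ1 : τ ≤ 1 := Real.rpow_le_one hδ0.le hδ1.le (by norm_num)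
  have hδτ : δ ^ 2 ≤ τ := by
    have h1 : δ ≤ τ := by
      calc δ = δ ^ (1 : ℝ) := (Real.rpow_one δ).symm
        _ ≤ τ := Real.rpow_le_rpow_of_exponent_ge hδ0 hδ1.le (by norm_num)
    nlinarith
  obtain ⟨η, hη0, hη⟩ := HeleShaw.exists_boundaryOp_near μ β hτ0
    (hR.contDiff.of_le (by norm_num)) (fun θ _ => hR.pos θ) hτ0
  have h2pi : (0 : ℝ) ≤ 2 * Real.pi := by positivity
  obtain ⟨ρ, hρ, hclose⟩ := HeleShaw.denseNets_of_bounded h2pi (n := 3) hΨ hΨ_bdd hΨ_nonconst R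
    hR.contDiff (min η δ) (lt_min hη0 hδ0)
  have hρ3 : ContDiff ℝ 3 ρ := HeleShaw.contDiff_of_mem_netSpan (n := 3) hΨ hρ
  obtain ⟨N, hN, hρN⟩ := HeleShaw.exists_mem_networks_of_mem_netSpan hρ
  obtain ⟨hpos, hop⟩ := hη ρ (hρ3.of_le (by norm_num)) fun α hα θ hθ =>
    (hclose α (by omega) θ hθ).trans (min_le_left _ _)
  have hδclose : ∀ α ≤ 3, ∀ θ ∈ Set.Icc (0 : ℝ) (2 * Real.pi),
      |iteratedDeriv α ρ θ - iteratedDeriv α R θ| ≤ δ := fun α hα θ hθ =>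
    (hclose α hα θ hθ).trans (min_le_right _ _)
  refine ⟨N, hN, ρ, hρN, hpos, hδclose, ?_⟩
  have hsup : ∀ φ ∈ Set.Icc (0 : ℝ) (2 * Real.pi),
      |HeleShaw.boundaryOp μ β τ ρ φ| ≤ (C + 1) * τ ^ (1 / 2 : ℝ) := by
    intro φ hφ
    have h1 := hC τ hτ0 hτ1 φ hφ
    have h2 := hop φ hφ
    have h3 : τ ≤ τ ^ (1 / 2 : ℝ) := by
      calc τ = τ ^ (1 : ℝ) := (Real.rpow_one τ).symm
        _ ≤ τ ^ (1 / 2 : ℝ) := Real.rpow_le_rpow_of_exponent_ge hτ0 hτ1 (by norm_num)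
    rw [abs_le] at h1 h2 ⊢
    constructor <;> linarith
  have hint := HeleShaw.integral_sq_mul_density_le hν hsup
  have hsq : ((C + 1) * τ ^ (1 / 2 : ℝ)) ^ 2 = (C + 1) ^ 2 * τ := by
    rw [mul_pow, ← Real.sqrt_eq_rpow, Real.sq_sqrt hτ0.le]
  have hpen := HeleShaw.penalty_le hR.periodic fun α hα => hδclose α (by omega)
  rw [HeleShaw.loss]
  rw [hsq] at hint
  linarith
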